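/- Setting. Fix a set $\mathbf V$ of program variables, each variable $v$ having a nonempty (possibly infinite) set $T_v$ of values. For a set $X\subseteq\mathbf V$ let $\ell^2[X]$ be the Hilbert space with orthonormal basis $\{|m\rangle\}$, $m$ ranging over all assignments of values to the variables in $X$. Operators are bounded and linear; for finite $X$, an operator $U$ on $\ell^2[X]$ is extended to $\ell^2[\mathbf V]$ as $U\otimes\mathrm{id}$. A mixed memory is a positive trace-class operator (of arbitrary trace). A binary measurement $M$ on $\ell^2[X]$ is a pair of operators $M_{\mathsf{true}},M_{\mathsf{false}}$ with $M_{\mathsf{true}}^*M_{\mathsf{true}}+M_{\mathsf{false}}^*M_{\mathsf{false}}=\mathrm{id}$. Programs are built by the grammar $$c,d ::= \mathsf{apply}\ U[X]\mid \mathsf{init}\ X:=\psi\mid \mathsf{if}\ M[X]\ c\ d\mid \mathsf{while}\ M[X]\ c\mid c;d\mid \mathsf{skip}$$ with $X$ a finite set of variables, $U$ an isometry on $\ell^2[X]$, $\psi\in\ell^2[X]$ a unit vector and $M$ a binary measurement on $\ell^2[X]$. With ${\downarrow_t}(\rho):=M_t\rho M_t^*$ (where $M_t$ is extended to $\ell^2[\mathbf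 V]$), the semantics on mixed memories $\rho$ over $\mathbf V$ is $[\![\mathsf{apply}\ U[X]]\!](\rho)=U\rho U^*$, $[\![\mathsf{init}\ X:=\psi]\!](\rho)=|\psi\rangle\langle\psi|\otimes\mathrm{tr}_X\rho$, $[\![\mathsf{if}\ M[X]\ c\ d]\!](\rho)=[\![c]\!]({\downarrow_{\mathsf{true}}}(\rho))+[\![d]\!]({\downarrow_{\mathsf{false}}}(\rho))$, $[\![\mathsf{while}\ M[X]\ c]\!](\rho)=\sum_{n\ge0}{\downarrow_{\mathsf{false}}}\bigl(([\![c]\!]\circ{\downarrow_{\mathsf{true}}})^n(\rho)\bigr)$, $[\![c;d]\!]=[\![d]\!]\circ[\![c]\!]$, $[\![\mathsf{skip}]\!]=\mathrm{id}$. The program $c$ is terminating if $\mathrm{tr}\,[\![c]\!](\rho)=\mathrm{tr}\,\rho$ for all mixed memories $\rho$. Let $\mathbf V_1,\mathbf V_2$ be two disjoint copies of $\mathbf V$. An expectation is a positive operator on $\ell^2[\mathbf V_1\mathbf V_2]=\ell^2[\mathbf V_1]\otimes\ell^2[\mathbf V_2]$. A mixed memory $\rho$ over $\mathbf V_1\mathbf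 V_2$ is separable if $\rho=\sum_i\rho_i\otimes\rho_i'$ (convergence in trace norm) for mixed memories $\rho_i$ over $\mathbf V_1$ and $\rho_i'$ over $\mathbf V_2$. For expectations $A,B$ and programs $c,d$, the judgment $\{A\}\,c\sim d\,\{B\}$ means: for every separable mixed memory $\rho$ over $\mathbf V_1\mathbf V_2$ there is a separable mixed memory $\rho'$ over $\mathbf V_1\mathbf V_2$ with $$\mathrm{tr}_{\mathbf V_2}\rho'=[\![c]\!](\mathrm{tr}_{\mathbf V_2}\rho),\qquad \mathrm{tr}_{\mathbf V_1}\rho'=[\![d]\!](\mathrm{tr}_{\mathbf V_1}\rho),\qquad \mathrm{tr}\,A\rho\le\mathrm{tr}\,B\rho'.$$ Let $X,Y$ be finite sets of variables, $M$ and $N$ binary measurements on $\ell^2[X]$ and $\ell^2[Y]$, let $c_{\mathsf{true}},c_{\mathsf{false}},d_{\mathsf{true}},d_{\mathsf{false}}$ be programs, and $B$ an expectation. Let $M_t^{(1)}$ and $N_u^{(2)}$ denote $M_t$ acting on the variables $X$ of the first copy and $N_u$ acting on the variables $Y$ of the second copy, and put $${\downarrow^*_{t,u}}(A):=(M_t^{(1)})^*\,(N_u^{(2)})^*\,A\,N_u^{(2)}\,M_t^{(1)}\qquad(t,u\in\{\mathsf{true},\mathsf{false}\}).$$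 (JointIf4) Let $A_{t,u}$, $t,u\in\{\mathsf{true},\mathsf{false}\}$, be expectations with $\{A_{t,u}\}\,c_t\sim d_u\,\{B\}$ for all $t,u$. Then $\sum_{t,u}{\downarrow^*_{t,u}}(A_{t,u})$ is an expectation and $$\Bigl\{\sum_{t,u}{\downarrow^*_{t,u}}(A_{t,u})\Bigr\}\ \mathsf{if}\ M[X]\ c_{\mathsf{true}}\ c_{\mathsf{false}}\ \sim\ \mathsf{if}\ N[Y]\ d_{\mathsf{true}}\ d_{\mathsf{false}}\ \{B\}.$$ (JointIf) Let $A_{\mathsf{true}},A_{\mathsf{false}}$ be expectations with $\{A_t\}\,c_t\sim d_t\,\{B\}$ for $t\in\{\mathsf{true},\mathsf{false}\}$, and suppose that $c_{\mathsf{true}},c_{\mathsf{false}},d_{\mathsf{true}},d_{\mathsf{false}}$ are terminating. Then ${\downarrow^*_{\mathsf{true},\mathsf{true}}}(A_{\mathsf{true}})+{\downarrow^*_{\mathsf{false},\mathsf{false}}}(A_{\mathsf{false}})$ is an expectation and $$\bigl\{{\downarrow^*_{\mathsf{true},\mathsf{true}}}(A_{\mathsf{true}})+{\downarrow^*_{\mathsf{false},\mathsf{false}}}(A_{\mathsf{false}})\bigr\}\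 \mathsf{if}\ M[X]\ c_{\mathsf{true}}\ c_{\mathsf{false}}\ \sim\ \mathsf{if}\ N[Y]\ d_{\mathsf{true}}\ d_{\mathsf{false}}\ \{B\}.$$ -/

import Mathlib

noncomputable section

namespace QRHL

/-! ### Hilbert spaces with a canonical basis, operators, trace -/

/-- `ℓ²(X)`: the Hilbert space with orthonormal basis `|x⟩`, `x ∈ X` (`X` arbitrary). -/
abbrev Ell2 (X : Type*) : Type _ := lp (fun _ : X => ℂ) 2

/-- Bounded linear operators on `ℓ²(X)`. -/
abbrev Op (X : Type*) : Type _ := Ell2 X →L[ℂ] Ell2 X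

theorem memℓp_two_iff {X : Type*} (f : X → ℂ) :
    Memℓp f 2 ↔ Summable fun x => ‖f x‖ ^ 2 := by
  rw [memℓp_gen_iff (by norm_num)]
  norm_num

theorem summable_sq {X : Type*} (ψ : Ell2 X) : Summable fun x => ‖ψ x‖ ^ 2 :=
  (memℓp_two_iff _).1 (lp.memℓp ψ)

theorem norm_sq_eq {X : Type*} (ψ : Ell2 X) : ‖ψ‖ ^ 2 = ∑' x, ‖ψ x‖ ^ 2 := by
  have h := lp.norm_rpow_eq_tsum (p := 2) (by norm_num) ψ
  norm_num at h
  exact h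

open Classical in
/-- The basis vector `|x⟩`. -/
def ket {X : Type*} (x : X) : Ell2 X := lp.single 2 x 1

/-- The trace `∑ₓ ⟨x| T |x⟩`. -/
def tr {X : Type*} (T : Op X) : ℂ := ∑' x, inner ℂ (ket x) (T (ket x))

/-- The absolute value `|T| = √(T* T)` of a bounded operator. -/
def absOp {H : Type*} [NormedAddCommGroup H] [InnerProductSpace ℂ H] [CompleteSpace H]
    (T : H →L[ℂ] H) : H →L[ℂ] H := CFC.abs T

/-- The trace norm `‖T‖₁ = tr |T|`, with value `∞` if `T` is not trace class. -/
def traceNorm {X : Type*} (T : Op X) : ENNReal :=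
  ∑' x, ENNReal.ofReal (inner ℂ (ket x) (absOp T (ket x))).re

def IsTraceClass {X : Type*} (T : Op X) : Prop := traceNorm T ≠ ⊤

/-- `T = ∑ᵢ f i`, the sum over an arbitrary index set converging in trace norm. -/
def HasTraceSum {X ι : Type*} (f : ι → Op X) (T : Op X) : Prop :=
  Filter.Tendsto (fun s : Finset ι => traceNorm (T - ∑ i ∈ s, f i)) Filter.atTop (nhds 0)

/-- Mixed states: positive trace class operators (not necessarily of trace one). -/
def IsMixed {X : Type*} (ρ : Op X) : Prop := ρ.IsPositive ∧ IsTraceClass ρ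

/-- Expectations: positive bounded operators. -/
def IsExpectation {X : Type*} (A : Op X) : Prop := A.IsPositive

/-- `|ψ⟩⟨ψ|`. -/
def proj {X : Type*} (ψ : Ell2 X) : Op X := InnerProductSpace.rankOne ℂ ψ ψ

/-! ### Change of index set -/

/-- The unitary `ℓ²(X) → ℓ²(Y)`, `|x⟩ ↦ |e x⟩`. -/
def relabel {X Y : Type*} (e : X ≃ Y) : Ell2 X ≃ₗᵢ[ℂ] Ell2 Y where
  toFun ψ := ⟨fun y => ψ (e.symm y),
    (memℓp_two_iff _).2 (e.symm.summable_iff.2 (summable_sq ψ))⟩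
  invFun φ := ⟨fun x => φ (e x), (memℓp_two_iff _).2 (e.summable_iff.2 (summable_sq φ))⟩
  map_add' _ _ := rfl
  map_smul' _ _ := rfl
  left_inv ψ := by ext x; exact congrArg ψ (e.symm_apply_apply x)
  right_inv φ := by ext y; exact congrArg φ (e.apply_symm_apply y)
  norm_map' ψ := by
    rw [← sq_eq_sq₀ (norm_nonneg _) (norm_nonneg _), norm_sq_eq, norm_sq_eq]
    exact e.symm.tsum_eq (fun x => ‖ψ x‖ ^ 2)

/-- The operator `T` on `ℓ²(X)`, seen as an operator on `ℓ²(Y)` along `e : X ≃ Y`. -/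
def relabelOp {X Y : Type*} (e : X ≃ Y) (T : Op X) : Op Y :=
  ((relabel e).toContinuousLinearEquiv : Ell2 X →L[ℂ] Ell2 Y) ∘L T ∘L
    ((relabel e).symm.toContinuousLinearEquiv : Ell2 Y →L[ℂ] Ell2 X)

/-! ### Tensor products, with `ℓ²(X) ⊗ ℓ²(Y) = ℓ²(X × Y)` -/

/-- The operator `id ⊗ ⟨y| : ℓ²(X × Y) → ℓ²(X)`. -/
def slice {X Y : Type*} (y : Y) : Ell2 (X × Y) →L[ℂ] Ell2 X :=
  LinearMap.mkContinuous
    { toFun := fun ψ => (⟨fun x => ψ (x, y), (memℓp_two_iff _).2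
        ((summable_sq ψ).comp_injective (i := fun x => (x, y))
          (fun _ _ h => (Prod.ext_iff.1 h).1))⟩ : Ell2 X)
      map_add' := fun _ _ => rfl
      map_smul' := fun _ _ => rfl } 1 (by
    intro ψ
    rw [one_mul, ← sq_le_sq₀ (norm_nonneg _) (norm_nonneg _), norm_sq_eq, norm_sq_eq]
    exact tsum_comp_le_tsum_of_inj (summable_sq ψ) (fun _ => sq_nonneg _)
      (i := fun x => (x, y)) (fun _ _ h => (Prod.ext_iff.1 h).1))

theorem slice_apply {X Y : Type*} (y : Y) (ψ : Ell2 (X × Y)) (x : X) :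
    slice y ψ x = ψ (x, y) := rfl

theorem summable_slice {X Y : Type*} (ψ : Ell2 (X × Y)) :
    Summable fun y => ‖slice y ψ‖ ^ 2 := by
  have h : Summable fun p : Y × X => ‖ψ (p.2, p.1)‖ ^ 2 :=
    (Equiv.prodComm Y X).summable_iff.2 (summable_sq ψ)
  simpa only [norm_sq_eq, slice_apply] using h.prod

theorem norm_sq_eq_slice {X Y : Type*} (ψ : Ell2 (X × Y)) :
    ‖ψ‖ ^ 2 = ∑' y, ‖slice y ψ‖ ^ 2 := by
  have h : Summable fun p : Y × X => ‖ψ (p.2, p.1)‖ ^ 2 :=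
    (Equiv.prodComm Y X).summable_iff.2 (summable_sq ψ)
  have h2 := h.tsum_prod
  rw [norm_sq_eq, ← (Equiv.prodComm Y X).tsum_eq]
  simp only [norm_sq_eq, slice_apply]
  exact h2

theorem summable_tensorId {X Y : Type*} (A : Op X) (ψ : Ell2 (X × Y)) :
    Summable fun p : Y × X => ‖A (slice p.1 ψ) p.2‖ ^ 2 := by
  refine (summable_prod_of_nonneg (fun _ => sq_nonneg _)).2
    ⟨fun y => summable_sq (A (slice y ψ)), ?_⟩
  simp only [← norm_sq_eq]
  refine Summable.of_nonneg_of_le (fun _ => sq_nonneg _) (fun y => ?_)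
    ((summable_slice ψ).mul_left (‖A‖ ^ 2))
  rw [← mul_pow]
  exact pow_le_pow_left₀ (norm_nonneg _) (A.le_opNorm _) 2

/-- The operator `A ⊗ id` on `ℓ²(X × Y)`: it applies `A` to every slice `ψ(·, y)`. -/
def tensorId {X : Type*} (Y : Type*) (A : Op X) : Op (X × Y) :=
  LinearMap.mkContinuous
    { toFun := fun ψ => (⟨fun p => A (slice p.2 ψ) p.1, (memℓp_two_iff _).2
        ((Equiv.prodComm X Y).summable_iff.2 (summable_tensorId A ψ))⟩ : Ell2 (X × Y))
      map_add' := fun ψ φ => by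
        ext p
        change A (slice p.2 (ψ + φ)) p.1 = A (slice p.2 ψ) p.1 + A (slice p.2 φ) p.1
        rw [map_add, map_add]; rfl
      map_smul' := fun c ψ => by
        ext p
        change A (slice p.2 (c • ψ)) p.1 = c • A (slice p.2 ψ) p.1
        rw [map_smul, map_smul]; rfl } ‖A‖ (by
    intro ψ
    rw [← sq_le_sq₀ (norm_nonneg _) (by positivity), mul_pow, norm_sq_eq_slice,
      norm_sq_eq_slice ψ, ← tsum_mul_left]
    refine Summable.tsum_le_tsum (fun y => ?_) (summable_slice _)
      ((summable_slice ψ).mul_left _)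
    rw [← mul_pow]
    exact pow_le_pow_left₀ (norm_nonneg _) (A.le_opNorm (slice y ψ)) 2)

/-- The operator `id ⊗ B` on `ℓ²(X × Y)`. -/
def idTensor (X : Type*) {Y : Type*} (B : Op Y) : Op (X × Y) :=
  relabelOp (Equiv.prodComm Y X) (tensorId X B)

/-- The operator `A ⊗ B` on `ℓ²(X × Y)`. -/
def tensorOp {X Y : Type*} (A : Op X) (B : Op Y) : Op (X × Y) :=
  tensorId Y A * idTensor X B

/-- Partial trace over the second factor, `∑_y (id ⊗ ⟨y|) ρ (id ⊗ |y⟩)`. For trace class `ρ`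
this series converges in trace norm, hence in operator norm and to the same operator. -/
def ptraceSnd {X Y : Type*} (ρ : Op (X × Y)) : Op X :=
  ∑' y, slice y ∘L ρ ∘L ContinuousLinearMap.adjoint (slice y)

/-- Partial trace over the first factor. -/
def ptraceFst {X Y : Type*} (ρ : Op (X × Y)) : Op Y :=
  ptraceSnd (relabelOp (Equiv.prodComm X Y) ρ)

/-- Separable mixed states on `ℓ²(X) ⊗ ℓ²(Y)`: `ρ = ∑ᵢ ρᵢ ⊗ ρᵢ'` with mixed states `ρᵢ`, `ρᵢ'`,
convergence in trace norm. Only countably many summands can be nonzero, so that the universe of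
the index set is immaterial. -/
def IsSeparable {X Y : Type*} (ρ : Op (X × Y)) : Prop :=
  IsMixed ρ ∧ ∃ (ι : Type) (ρ₁ : ι → Op X) (ρ₂ : ι → Op Y),
    (∀ i, IsMixed (ρ₁ i)) ∧ (∀ i, IsMixed (ρ₂ i)) ∧
      HasTraceSum (fun i => tensorOp (ρ₁ i) (ρ₂ i)) ρ

/-! ### Variables and memories -/

/-- Assignments over all program variables; `V` is the set of program variables,
`T v` the type of the variable `v`. -/
abbrev Mem {V : Type*} (T : V → Type*) : Type _ := ∀ v, T v

/-- Assignments over the variables in `X`. -/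
abbrev MemOn {V : Type*} (T : V → Type*) (X : Finset V) : Type _ := ∀ v : {v // v ∈ X}, T v

/-- Assignments over the variables not in `X`. -/
abbrev MemOff {V : Type*} (T : V → Type*) (X : Finset V) : Type _ := ∀ v : {v // v ∉ X}, T v

open Classical in
/-- An assignment is a pair of an assignment over `X` and an assignment over the other variables. -/
def splitMem {V : Type*} (T : V → Type*) (X : Finset V) : Mem T ≃ MemOn T X × MemOff T X :=
  Equiv.piEquivPiSubtypeProd (fun v => v ∈ X) T

/-- The operator `U` on the variables `X`, extended by the identity to all program variables. -/
def onVars {V : Type*} {T : V → Type*} (X : Finset V) (U : Op (MemOn T X)) : Op (Mem T) :=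
  relabelOp (splitMem T X).symm (tensorId (MemOff T X) U)

/-! ### Programs and their semantics -/

/-- A binary measurement with outcomes `true`, `false`, given by its Kraus operators. -/
structure BinMeas (X : Type*) where
  op : Bool → Op X
  complete : ContinuousLinearMap.adjoint (op true) * op true +
    ContinuousLinearMap.adjoint (op false) * op false = 1

/-- Programs over the variables `V` with types `T`. -/
inductive Prog {V : Type*} (T : V → Type*) where
  | apply (X : Finset V) (U : Ell2 (MemOn T X) →ₗᵢ[ℂ] Ell2 (MemOn T X))
  | init (X : Finset V) (ψ : Ell2 (MemOn T X)) (hψ : ‖ψ‖ = 1)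
  | ifte (X : Finset V) (M : BinMeas (MemOn T X)) (c d : Prog T)
  | while (X : Finset V) (M : BinMeas (MemOn T X)) (c : Prog T)
  | seq (c d : Prog T)
  | skip

/-- The unnormalized state after outcome `t` of the measurement `M` of the variables `X`. -/
def restrict {V : Type*} {T : V → Type*} (X : Finset V) (M : BinMeas (MemOn T X)) (t : Bool)
    (ρ : Op (Mem T)) : Op (Mem T) :=
  onVars X (M.op t) * ρ * ContinuousLinearMap.adjoint (onVars X (M.op t))

/-- Denotational semantics; only its values on mixed memories matter. For a mixed memory the
series for `while` converges in trace norm, hence in operator norm and to the same operator. -/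
def denot {V : Type*} {T : V → Type*} : Prog T → Op (Mem T) → Op (Mem T)
  | .apply X U => fun ρ => onVars X U.toContinuousLinearMap * ρ *
      ContinuousLinearMap.adjoint (onVars X U.toContinuousLinearMap)
  | .init X ψ _ => fun ρ => relabelOp (splitMem T X).symm
      (tensorOp (proj ψ) (ptraceFst (relabelOp (splitMem T X) ρ)))
  | .ifte X M c d => fun ρ => denot c (restrict X M true ρ) + denot d (restrict X M false ρ)
  | .while X M c => fun ρ =>
      ∑' n : ℕ, restrict X M false ((fun σ => denot c (restrict X M true σ))^[n] ρ)
  | .seq c d => fun ρ => denot d (denot c ρ)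
  | .skip => fun ρ => ρ

/-- `c` is terminating: its semantics preserves the trace of every mixed memory. -/
def Prog.Terminating {V : Type*} {T : V → Type*} (c : Prog T) : Prop :=
  ∀ ρ : Op (Mem T), IsMixed ρ → tr (denot c ρ) = tr ρ

/-! ### Judgments -/

/-- The judgment `{A} c ~ d {B}` for expectations `A`, `B` over two copies of the program
variables. The traces of `A ρ` and `B ρ'` are real numbers. -/
def rhl {V : Type*} {T : V → Type*} (A : Op (Mem T × Mem T)) (c d : Prog T)
    (B : Op (Mem T × Mem T)) : Prop :=
  ∀ ρ : Op (Mem T × Mem T), IsSeparable ρ →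
    ∃ ρ' : Op (Mem T × Mem T), IsSeparable ρ' ∧
      ptraceSnd ρ' = denot c (ptraceSnd ρ) ∧
      ptraceFst ρ' = denot d (ptraceFst ρ) ∧
      (tr (A * ρ)).re ≤ (tr (B * ρ')).re

/-- `↓*_{t,u}(A) = M_t(X₁)* N_u(Y₂)* A N_u(Y₂) M_t(X₁)`, where `X₁` are the variables `X` of the
first copy and `Y₂` the variables `Y` of the second copy. -/
def restrictStar {V : Type*} {T : V → Type*} (X : Finset V) (M : BinMeas (MemOn T X))
    (Y : Finset V) (N : BinMeas (MemOn T Y)) (t u : Bool) (A : Op (Mem T × Mem T)) :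
    Op (Mem T × Mem T) :=
  ContinuousLinearMap.adjoint (tensorId (Mem T) (onVars X (M.op t))) *
    ContinuousLinearMap.adjoint (idTensor (Mem T) (onVars Y (N.op u))) * A *
    idTensor (Mem T) (onVars Y (N.op u)) * tensorId (Mem T) (onVars X (M.op t))

end QRHL

end

noncomputable section

namespace QRHL

open ContinuousLinearMap Filter Topology

variable {X Y Z ι : Type*}

/-! ### Basis vectors -/

/-! For (JointIf4), both copies of a separable `ρ` are measured, giving `ρ_{tu} = (M_t ⊗ N_u) ρ (M_t
⊗ N_u)*`. Each `ρ_{tu}` is separable because conjugation by a product operator respects product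
states. The hypotheses supply couplings `ρ'_{tu}`, and their sum is the required witness
(`rhl_ifte`). Its marginals are correct for two reasons: a measurement on one copy with forgotten
outcome does not change the marginal on the other (`ptraceSnd_conj_idTensor_add`), and program
semantics is additive on mixed memories (`isQuantumOp_denot`). The inequality follows by cyclicity,
`tr(K* A K ρ) = tr(A K ρ K*)` (`tr_mul_conj`).

(JointIf) is the case of (JointIf4) with precondition `0` on the two mixed outcomes. Those judgments
hold for terminating programs, since both outputs have trace `tr ρ` and their normalized product
couples them (`rhl_zero`).

The analysis rests on the trace `trE` of positive operators with values in `[0, ∞]`. Factoring `T =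
S* S` turns it into a Hilbert–Schmidt sum, where summations may be exchanged freely. It dominates
the operator norm, so a bound on traces makes a positive series converge in operator norm; for
positive terms with sum of finite trace, trace-norm convergence is then automatic. -/

theorem inner_ket (x : X) (ψ : Ell2 X) : inner ℂ (ket x) ψ = ψ x := by
  classical
  have h := lp.inner_single_left (𝕜 := ℂ) x (1 : ℂ) ψ
  simp only [RCLike.inner_apply, map_one, mul_one] at h
  rw [← h, ket]

theorem ket_apply_self (x : X) : (ket x : Ell2 X) x = 1 := by
  simp [ket]

theorem ket_apply_ne {x y : X} (h : y ≠ x) : (ket x : Ell2 X) y = 0 := by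
  simp [ket, h]

theorem hasSum_ket (ψ : Ell2 X) : HasSum (fun x => ψ x • (ket x : Ell2 X)) ψ := by
  classical
  have h := lp.hasSum_single (p := 2) (by norm_num) ψ
  refine h.congr_fun ?_ |> fun h => h
  intro x
  ext y
  by_cases hy : y = x
  · subst hy; simp [ket]
  · simp [ket, hy]

theorem ext_ket {F : Type*} [NormedAddCommGroup F] [NormedSpace ℂ F] {S T : Ell2 X →L[ℂ] F}
    (h : ∀ x, S (ket x) = T (ket x)) : S = T := by
  ext1 ψ
  refine ((hasSum_ket ψ).mapL S).unique ?_
  convert (hasSum_ket ψ).mapL T using 2 with x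
  simp [h]

theorem ofReal_norm_sq (ψ : Ell2 X) :
    ENNReal.ofReal (‖ψ‖ ^ 2) = ∑' x, ENNReal.ofReal (‖ψ x‖ ^ 2) := by
  rw [norm_sq_eq, ENNReal.ofReal_tsum_of_nonneg (fun _ => sq_nonneg _) (summable_sq ψ)]

/-- Both sides are the sum of the squared moduli of all matrix entries of `A`, by columns and by
rows. -/
theorem tsum_norm_sq_adjoint (A : Ell2 X →L[ℂ] Ell2 Y) :
    ∑' x, ENNReal.ofReal (‖A (ket x)‖ ^ 2) = ∑' y, ENNReal.ofReal (‖adjoint A (ket y)‖ ^ 2) := by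
  simp only [ofReal_norm_sq]
  rw [ENNReal.tsum_comm]
  refine tsum_congr fun y => tsum_congr fun x => ?_
  rw [← inner_ket, ← inner_ket, norm_inner_symm, adjoint_inner_right]

/-! ### Positive operators and their trace in `[0, ∞]` -/

theorem exists_adjoint_comp_self {H : Type*} [NormedAddCommGroup H] [InnerProductSpace ℂ H]
    [CompleteSpace H] {T : H →L[ℂ] H} (hT : T.IsPositive) :
    ∃ S : H →L[ℂ] H, T = adjoint S ∘L S :=
  CStarAlgebra.nonneg_iff_eq_star_mul_self.1 ((nonneg_iff_isPositive T).2 hT)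

/-- The expectation value `⟨ψ| T |ψ⟩` of a positive operator. -/
def expVal (T : Op X) (ψ : Ell2 X) : ENNReal := ENNReal.ofReal (inner ℂ ψ (T ψ)).re

/-- The trace of a positive operator, with values in `[0, ∞]`. -/
def trE (T : Op X) : ENNReal := ∑' x, expVal T (ket x)

/-- The operator `K T K*`. -/
def conj (K : Ell2 X →L[ℂ] Ell2 Y) (T : Op X) : Op Y := K ∘L T ∘L adjoint K

theorem expVal_conj (K : Ell2 X →L[ℂ] Ell2 Y) (T : Op X) (ψ : Ell2 Y) :
    expVal (conj K T) ψ = expVal T (adjoint K ψ) := by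
  simp [expVal, conj, adjoint_inner_left]

theorem expVal_adjoint_comp_self (S : Ell2 X →L[ℂ] Ell2 Y) (ψ : Ell2 X) :
    expVal (adjoint S ∘L S) ψ = ENNReal.ofReal (‖S ψ‖ ^ 2) := by
  rw [expVal, comp_apply, adjoint_inner_right, inner_self_eq_norm_sq_to_K]
  norm_cast

theorem expVal_add {S T : Op X} (hS : S.IsPositive) (hT : T.IsPositive) (ψ : Ell2 X) :
    expVal (S + T) ψ = expVal S ψ + expVal T ψ := by
  simp only [expVal, add_apply, inner_add_right, Complex.add_re]
  exact ENNReal.ofReal_add (hS.re_inner_nonneg_right ψ) (hT.re_inner_nonneg_right ψ)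

theorem trE_add {S T : Op X} (hS : S.IsPositive) (hT : T.IsPositive) :
    trE (S + T) = trE S + trE T := by
  simp only [trE, expVal_add hS hT, ENNReal.tsum_add]

theorem hasSum_expVal {f : ι → Op X} {T : Op X} (h : HasSum f T) (hf : ∀ i, (f i).IsPositive)
    (ψ : Ell2 X) : expVal T ψ = ∑' i, expVal (f i) ψ := by
  have h1 : HasSum (fun i => (inner ℂ ψ (f i ψ)).re) (inner ℂ ψ (T ψ)).re :=
    h.mapL (Complex.reCLM ∘L ((innerSL ℂ ψ).restrictScalars ℝ) ∘L
      ((apply ℂ (Ell2 X) ψ).restrictScalars ℝ))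
  rw [expVal, ← h1.tsum_eq]
  exact ENNReal.ofReal_tsum_of_nonneg
    (fun i => (hf i).re_inner_nonneg_right ψ) h1.summable

theorem isPositive_of_hasSum {f : ι → Op X} {T : Op X} (h : HasSum f T)
    (hf : ∀ i, (f i).IsPositive) : T.IsPositive := by
  rw [isPositive_iff_complex]
  intro ψ
  have h1 : HasSum (fun i => inner ℂ (f i ψ) ψ) (inner ℂ (T ψ) ψ) := by
    have := (h.mapL (apply ℂ (Ell2 X) ψ)).mapL (innerSL ℂ ψ)
    have := this.mapL (Complex.conjCLE : ℂ →L[ℝ] ℂ)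
    simpa using this
  have hc i := (isPositive_iff_complex _).1 (hf i) ψ
  have h2 : HasSum (fun i => (inner ℂ (f i ψ) ψ).re) (inner ℂ (T ψ) ψ).re :=
    h1.mapL Complex.reCLM
  refine ⟨?_, h2.nonneg fun i => (hc i).2⟩
  refine HasSum.unique (h2.mapL Complex.ofRealCLM) ?_
  convert h1 using 2 with i
  exact (hc i).1

theorem trE_hasSum {f : ι → Op X} {T : Op X} (h : HasSum f T) (hf : ∀ i, (f i).IsPositive) :
    trE T = ∑' i, trE (f i) := by
  simp only [trE, hasSum_expVal h hf]
  exact ENNReal.tsum_comm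

/-- The trace is the squared Hilbert–Schmidt norm of `S K*`, hence that of its adjoint `K S*`. With
`K` outermost, pointwise statements about `‖K ψ‖` (bounds, isometry, completeness of a measurement)
pass termwise to traces. -/
theorem trE_conj (K : Ell2 X →L[ℂ] Ell2 Y) (S : Op X) :
    trE (conj K (adjoint S ∘L S)) = ∑' x, ENNReal.ofReal (‖K (adjoint S (ket x))‖ ^ 2) := by
  have h := tsum_norm_sq_adjoint (K ∘L adjoint S)
  rw [adjoint_comp, adjoint_adjoint] at h
  simp only [comp_apply] at h
  rw [h, trE]
  exact tsum_congr fun y => by rw [expVal_conj, expVal_adjoint_comp_self]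

theorem conj_one (T : Op X) : conj (1 : Op X) T = T := by
  ext1 ψ
  change T (adjoint (ContinuousLinearMap.id ℂ (Ell2 X)) ψ) = _
  rw [adjoint_id]; rfl

theorem trE_adjoint_comp_self (S : Op X) :
    trE (adjoint S ∘L S) = ∑' x, ENNReal.ofReal (‖adjoint S (ket x)‖ ^ 2) := by
  have := trE_conj (1 : Op X) S
  rwa [conj_one] at this

theorem IsPositive.conj {T : Op X} (hT : T.IsPositive) (K : Ell2 X →L[ℂ] Ell2 Y) :
    (QRHL.conj K T).IsPositive := hT.conj_adjoint K

theorem trE_conj_le (K : Ell2 X →L[ℂ] Ell2 Y) {T : Op X} (hT : T.IsPositive) :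
    trE (conj K T) ≤ ENNReal.ofReal (‖K‖ ^ 2) * trE T := by
  obtain ⟨S, rfl⟩ := exists_adjoint_comp_self hT
  rw [trE_conj, trE_adjoint_comp_self, ← ENNReal.tsum_mul_left]
  refine ENNReal.tsum_le_tsum fun x => ?_
  rw [← ENNReal.ofReal_mul (sq_nonneg _), ← mul_pow]
  exact ENNReal.ofReal_le_ofReal (pow_le_pow_left₀ (norm_nonneg _) (K.le_opNorm _) 2)

theorem trE_conj_isometry {K : Ell2 X →L[ℂ] Ell2 Y} (hK : ∀ ψ, ‖K ψ‖ = ‖ψ‖) {T : Op X}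
    (hT : T.IsPositive) : trE (conj K T) = trE T := by
  obtain ⟨S, rfl⟩ := exists_adjoint_comp_self hT
  simp only [trE_conj, trE_adjoint_comp_self, hK]

theorem norm_sq_add_norm_sq {K L : Op X} (h : adjoint K * K + adjoint L * L = 1) (ψ : Ell2 X) :
    ‖K ψ‖ ^ 2 + ‖L ψ‖ ^ 2 = ‖ψ‖ ^ 2 := by
  have h1 : inner ℂ ψ ((adjoint K * K + adjoint L * L) ψ) = inner ℂ ψ ψ := by rw [h]; rfl
  change inner ℂ ψ (adjoint K (K ψ) + adjoint L (L ψ)) = _ at h1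
  rw [inner_add_right, adjoint_inner_right, adjoint_inner_right,
    inner_self_eq_norm_sq_to_K, inner_self_eq_norm_sq_to_K, inner_self_eq_norm_sq_to_K] at h1
  exact_mod_cast h1

theorem trE_conj_add_trE_conj {K L : Op X} (h : adjoint K * K + adjoint L * L = 1) {T : Op X}
    (hT : T.IsPositive) : trE (conj K T) + trE (conj L T) = trE T := by
  obtain ⟨S, rfl⟩ := exists_adjoint_comp_self hT
  rw [trE_conj, trE_conj, trE_adjoint_comp_self, ← ENNReal.tsum_add]
  refine tsum_congr fun x => ?_
  rw [← ENNReal.ofReal_add (sq_nonneg _) (sq_nonneg _), norm_sq_add_norm_sq h]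

/-- With `T = S* S` one has `‖T‖ = ‖S‖²`. Cauchy–Schwarz in each coordinate `⟨S* x, ψ⟩` of `S ψ`
bounds `‖S‖` by the Hilbert–Schmidt norm. -/
theorem ofReal_norm_le_trE {T : Op X} (hT : T.IsPositive) : ENNReal.ofReal ‖T‖ ≤ trE T := by
  by_cases htop : trE T = ⊤
  · simp [htop]
  obtain ⟨S, rfl⟩ := exists_adjoint_comp_self hT
  rw [norm_adjoint_comp_self]
  refine ENNReal.ofReal_le_of_le_toReal ?_
  set r := (trE (adjoint S ∘L S)).toReal with hr
  have hr0 : 0 ≤ r := ENNReal.toReal_nonneg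
  have key : ∀ ψ, ‖S ψ‖ ≤ √r * ‖ψ‖ := by
    intro ψ
    rw [← sq_le_sq₀ (norm_nonneg _) (by positivity), mul_pow, Real.sq_sqrt hr0,
      ← ENNReal.ofReal_le_ofReal_iff (by positivity), ENNReal.ofReal_mul hr0, hr,
      ENNReal.ofReal_toReal htop, trE_adjoint_comp_self, ofReal_norm_sq, ← ENNReal.tsum_mul_right]
    refine ENNReal.tsum_le_tsum fun x => ?_
    rw [← ENNReal.ofReal_mul (sq_nonneg _), ← mul_pow, ← inner_ket, ← adjoint_inner_left]
    exact ENNReal.ofReal_le_ofReal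
      (pow_le_pow_left₀ (norm_nonneg _) (norm_inner_le_norm _ _) 2)
  have h := S.opNorm_le_bound (Real.sqrt_nonneg r) key
  calc ‖S‖ * ‖S‖ ≤ √r * √r := mul_self_le_mul_self (norm_nonneg _) h
    _ = r := Real.mul_self_sqrt hr0

theorem summable_of_tsum_trE {f : ι → Op X} (hf : ∀ i, (f i).IsPositive)
    (h : ∑' i, trE (f i) ≠ ⊤) : Summable f := by
  refine Summable.of_norm_bounded (ENNReal.summable_toReal h) fun i => ?_
  exact (ENNReal.ofReal_le_iff_le_toReal (ENNReal.ne_top_of_tsum_ne_top h i)).1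
    (ofReal_norm_le_trE (hf i))

/-! ### Trace norm -/

theorem isPositive_absOp {H : Type*} [NormedAddCommGroup H] [InnerProductSpace ℂ H]
    [CompleteSpace H] (T : H →L[ℂ] H) : (absOp T).IsPositive :=
  (nonneg_iff_isPositive _).1 (CFC.abs_nonneg T)

theorem absOp_of_isPositive {H : Type*} [NormedAddCommGroup H] [InnerProductSpace ℂ H]
    [CompleteSpace H] {T : H →L[ℂ] H} (hT : T.IsPositive) : absOp T = T :=
  CFC.abs_of_nonneg T ((nonneg_iff_isPositive T).2 hT)

theorem norm_absOp {H : Type*} [NormedAddCommGroup H] [InnerProductSpace ℂ H]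
    [CompleteSpace H] (T : H →L[ℂ] H) : ‖absOp T‖ = ‖T‖ := CFC.norm_abs

theorem traceNorm_eq_trE_absOp (T : Op X) : traceNorm T = trE (absOp T) := rfl

theorem traceNorm_of_isPositive {T : Op X} (hT : T.IsPositive) : traceNorm T = trE T := by
  rw [traceNorm_eq_trE_absOp, absOp_of_isPositive hT]

theorem ofReal_norm_le_traceNorm (T : Op X) : ENNReal.ofReal ‖T‖ ≤ traceNorm T := by
  have h := ofReal_norm_le_trE (isPositive_absOp T)
  rwa [norm_absOp] at h

theorem isMixed_iff {ρ : Op X} : IsMixed ρ ↔ ρ.IsPositive ∧ trE ρ ≠ ⊤ :=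
  and_congr_right fun h => by rw [IsTraceClass, traceNorm_of_isPositive h]

theorem IsMixed.pos {ρ : Op X} (h : IsMixed ρ) : ρ.IsPositive := h.1

theorem IsMixed.trE_ne_top {ρ : Op X} (h : IsMixed ρ) : trE ρ ≠ ⊤ := (isMixed_iff.1 h).2

theorem IsMixed.add {ρ σ : Op X} (hρ : IsMixed ρ) (hσ : IsMixed σ) : IsMixed (ρ + σ) :=
  isMixed_iff.2 ⟨hρ.pos.add hσ.pos, by
    rw [trE_add hρ.pos hσ.pos]; exact ENNReal.add_ne_top.2 ⟨hρ.trE_ne_top, hσ.trE_ne_top⟩⟩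

theorem IsMixed.conj {ρ : Op X} (hρ : IsMixed ρ) (K : Ell2 X →L[ℂ] Ell2 Y) :
    IsMixed (QRHL.conj K ρ) :=
  isMixed_iff.2 ⟨IsPositive.conj hρ.pos K, ne_top_of_le_ne_top
    (ENNReal.mul_ne_top ENNReal.ofReal_ne_top hρ.trE_ne_top) (trE_conj_le K hρ.pos)⟩

theorem hasSum_of_hasTraceSum {f : ι → Op X} {T : Op X} (h : HasTraceSum f T) : HasSum f T := by
  rw [HasSum, tendsto_iff_norm_sub_tendsto_zero]
  have h1 : Tendsto (fun s : Finset ι => ENNReal.ofReal ‖T - ∑ i ∈ s, f i‖) atTop (𝓝 0) :=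
    tendsto_of_tendsto_of_tendsto_of_le_of_le tendsto_const_nhds h (fun _ => zero_le)
      fun s => ofReal_norm_le_traceNorm _
  have h2 := (ENNReal.tendsto_toReal ENNReal.zero_ne_top).comp h1
  refine h2.congr fun s => ?_
  simp [norm_sub_rev]

/-- The remainder after a finite set is itself a positive operator, so its trace norm is the tail of
a convergent series in `[0, ∞]`. -/
theorem hasTraceSum_of_hasSum {f : ι → Op X} {T : Op X} (h : HasSum f T)
    (hf : ∀ i, (f i).IsPositive) (hT : trE T ≠ ⊤) : HasTraceSum f T := by
  rw [trE_hasSum h hf] at hT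
  refine (ENNReal.tendsto_tsum_compl_atTop_zero hT).congr fun s => ?_
  have hs : HasSum (fun i : {i // i ∉ s} => f i) (T - ∑ i ∈ s, f i) :=
    (s.hasSum_compl_iff).2 (by simpa using h)
  rw [traceNorm_of_isPositive (isPositive_of_hasSum hs fun i => hf i),
    trE_hasSum hs fun i => hf i]

/-! ### Trace -/

/-- The product of two Hilbert–Schmidt operators has an absolutely summable double expansion of its
trace, by `|ab| ≤ a² + b²`; this justifies Fubini in `tr_comp_comm`. -/
theorem summable_tr_comp {A : Ell2 X →L[ℂ] Ell2 Y} {B : Ell2 Y →L[ℂ] Ell2 X}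
    (hA : ∑' x, ENNReal.ofReal (‖A (ket x)‖ ^ 2) ≠ ⊤)
    (hB : ∑' y, ENNReal.ofReal (‖B (ket y)‖ ^ 2) ≠ ⊤) :
    Summable fun p : X × Y => inner ℂ (ket p.1) (B (ket p.2)) * inner ℂ (ket p.2) (A (ket p.1)) := by
  have hA' : Summable fun p : X × Y => ‖A (ket p.1) p.2‖ ^ 2 := by
    simp only [ofReal_norm_sq] at hA
    rw [← ENNReal.tsum_prod] at hA
    simpa using ENNReal.summable_toReal hA
  have hB' : Summable fun p : X × Y => ‖B (ket p.2) p.1‖ ^ 2 := by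
    simp only [ofReal_norm_sq] at hB
    rw [ENNReal.tsum_comm, ← ENNReal.tsum_prod] at hB
    simpa using ENNReal.summable_toReal hB
  refine Summable.of_norm_bounded (hB'.add hA') fun p => ?_
  rw [inner_ket, inner_ket, norm_mul]
  nlinarith [sq_nonneg (‖B (ket p.2) p.1‖ - ‖A (ket p.1) p.2‖),
    sq_nonneg ‖B (ket p.2) p.1‖, sq_nonneg ‖A (ket p.1) p.2‖]

theorem inner_ket_comp (A : Ell2 X →L[ℂ] Ell2 Y) (B : Ell2 Y →L[ℂ] Ell2 X) (x : X) :
    inner ℂ (ket x) ((B ∘L A) (ket x)) =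
      ∑' y, inner ℂ (ket x) (B (ket y)) * inner ℂ (ket y) (A (ket x)) := by
  rw [comp_apply, ← adjoint_inner_left, lp.inner_eq_tsum]
  refine tsum_congr fun y => ?_
  rw [← adjoint_inner_left, inner_ket, RCLike.inner_apply, mul_comm, ← inner_ket y (adjoint B _),
    inner_conj_symm]

theorem tr_comp_comm {A : Ell2 X →L[ℂ] Ell2 Y} {B : Ell2 Y →L[ℂ] Ell2 X}
    (hA : ∑' x, ENNReal.ofReal (‖A (ket x)‖ ^ 2) ≠ ⊤)
    (hB : ∑' y, ENNReal.ofReal (‖B (ket y)‖ ^ 2) ≠ ⊤) :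
    tr (B ∘L A) = tr (A ∘L B) := by
  rw [tr, tr, tsum_congr (inner_ket_comp A B), tsum_congr (inner_ket_comp B A),
    ← Summable.tsum_comm (f := fun x y => inner ℂ (ket x) (B (ket y)) * inner ℂ (ket y) (A (ket x)))
      (summable_tr_comp hA hB)]
  exact tsum_congr fun y => tsum_congr fun x => mul_comm _ _

theorem summable_diag_comp {A : Ell2 X →L[ℂ] Ell2 Y} {B : Ell2 Y →L[ℂ] Ell2 X}
    (hA : ∑' x, ENNReal.ofReal (‖A (ket x)‖ ^ 2) ≠ ⊤)
    (hB : ∑' y, ENNReal.ofReal (‖B (ket y)‖ ^ 2) ≠ ⊤) :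
    Summable fun x => inner ℂ (ket x) ((B ∘L A) (ket x)) := by
  simp only [inner_ket_comp]
  exact (summable_tr_comp hA hB).prod

theorem tsum_norm_sq_comp_ne_top (L : Ell2 Y →L[ℂ] Ell2 Z) {A : Ell2 X →L[ℂ] Ell2 Y}
    (hA : ∑' x, ENNReal.ofReal (‖A (ket x)‖ ^ 2) ≠ ⊤) :
    ∑' x, ENNReal.ofReal (‖(L ∘L A) (ket x)‖ ^ 2) ≠ ⊤ := by
  refine ne_top_of_le_ne_top (ENNReal.mul_ne_top (a := ENNReal.ofReal (‖L‖ ^ 2))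
    ENNReal.ofReal_ne_top hA) ?_
  rw [← ENNReal.tsum_mul_left]
  refine ENNReal.tsum_le_tsum fun x => ?_
  rw [← ENNReal.ofReal_mul (sq_nonneg _), ← mul_pow]
  exact ENNReal.ofReal_le_ofReal (pow_le_pow_left₀ (norm_nonneg _) (L.le_opNorm _) 2)

theorem IsMixed.exists_sqrt {ρ : Op X} (hρ : IsMixed ρ) :
    ∃ S : Op X, ρ = adjoint S ∘L S ∧ ∑' x, ENNReal.ofReal (‖S (ket x)‖ ^ 2) ≠ ⊤ ∧
      ∑' x, ENNReal.ofReal (‖adjoint S (ket x)‖ ^ 2) ≠ ⊤ := by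
  obtain ⟨S, rfl⟩ := exists_adjoint_comp_self hρ.pos
  have h := hρ.trE_ne_top
  rw [trE_adjoint_comp_self] at h
  exact ⟨S, rfl, by rwa [tsum_norm_sq_adjoint], h⟩

theorem IsMixed.summable_diag {ρ : Op X} (hρ : IsMixed ρ) (A : Op X) :
    Summable fun x => inner ℂ (ket x) ((A * ρ) (ket x)) := by
  obtain ⟨S, rfl, h1, h2⟩ := hρ.exists_sqrt
  exact summable_diag_comp (B := A ∘L adjoint S) h1 (tsum_norm_sq_comp_ne_top A h2)

/-- For `ρ = S* S` with `S` Hilbert–Schmidt, both sides equal `tr (S K* A K S*)` by cyclicity. -/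
theorem tr_mul_conj {ρ : Op X} (hρ : IsMixed ρ) (A : Op Y) (K : Ell2 X →L[ℂ] Ell2 Y) :
    tr (A * conj K ρ) = tr ((adjoint K ∘L A ∘L K) * ρ) := by
  obtain ⟨S, rfl, h1, h2⟩ := hρ.exists_sqrt
  have h3 : ∑' y, ENNReal.ofReal (‖(S ∘L adjoint K) (ket y)‖ ^ 2) ≠ ⊤ := by
    rw [tsum_norm_sq_adjoint, adjoint_comp, adjoint_adjoint]
    exact tsum_norm_sq_comp_ne_top K h2
  exact (tr_comp_comm (A := S ∘L adjoint K) (B := (A ∘L K) ∘L adjoint S) h3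
    (tsum_norm_sq_comp_ne_top _ h2)).trans
    (tr_comp_comm (A := S) (B := (adjoint K ∘L A ∘L K) ∘L adjoint S) h1
    (tsum_norm_sq_comp_ne_top _ h2)).symm

theorem tr_add_mul {ρ : Op X} (hρ : IsMixed ρ) (A B : Op X) :
    tr ((A + B) * ρ) = tr (A * ρ) + tr (B * ρ) := by
  rw [tr, tr, tr, ← (hρ.summable_diag A).tsum_add (hρ.summable_diag B)]
  simp [add_mul]

theorem tr_mul_add {ρ σ : Op X} (hρ : IsMixed ρ) (hσ : IsMixed σ) (A : Op X) :
    tr (A * (ρ + σ)) = tr (A * ρ) + tr (A * σ) := by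
  rw [tr, tr, tr, ← (hρ.summable_diag A).tsum_add (hσ.summable_diag A)]
  simp

theorem IsMixed.ofReal_tr {ρ : Op X} (hρ : IsMixed ρ) : ENNReal.ofReal (tr ρ).re = trE ρ := by
  have h : Summable fun x => inner ℂ (ket x) (ρ (ket x)) := by simpa using hρ.summable_diag 1
  rw [tr, Complex.re_tsum h]
  exact ENNReal.ofReal_tsum_of_nonneg
    (fun x => hρ.pos.re_inner_nonneg_right _) (h.mapL Complex.reCLM)

/-- Writing `A = C* C`, cyclicity turns the trace into that of the positive operator `C ρ C*`. -/
theorem tr_mul_nonneg {A ρ : Op X} (hA : A.IsPositive) (hρ : IsMixed ρ) :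
    0 ≤ (tr (A * ρ)).re := by
  obtain ⟨C, rfl⟩ := exists_adjoint_comp_self hA
  have h := tr_mul_conj hρ 1 C
  rw [one_mul] at h
  have h2 : adjoint C ∘L (1 : Op X) ∘L C = adjoint C ∘L C := rfl
  rw [h2] at h
  rw [← h, tr, Complex.re_tsum (by simpa using (hρ.conj C).summable_diag 1)]
  exact tsum_nonneg fun x => (hρ.conj C).pos.re_inner_nonneg_right _

/-! ### Conjugation -/

theorem conj_add (K : Ell2 X →L[ℂ] Ell2 Y) (S T : Op X) : conj K (S + T) = conj K S + conj K T := by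
  simp [conj, add_comp, comp_add]

theorem conj_conj (K : Ell2 Y →L[ℂ] Ell2 Z) (L : Ell2 X →L[ℂ] Ell2 Y) (T : Op X) :
    conj K (conj L T) = conj (K ∘L L) T := by
  simp only [conj, adjoint_comp]
  rfl

theorem hasSum_conj (K : Ell2 X →L[ℂ] Ell2 Y) {f : ι → Op X} {T : Op X} (h : HasSum f T) :
    HasSum (fun i => conj K (f i)) (conj K T) := by
  have h1 := h.mapL ((compL ℂ (Ell2 Y) (Ell2 X) (Ell2 X)).flip (adjoint K))
  exact h1.mapL (compL ℂ (Ell2 Y) (Ell2 X) (Ell2 Y) K)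

theorem eq_of_expVal_eq {S T : Op X} (hS : S.IsPositive) (hT : T.IsPositive)
    (h : ∀ ψ, expVal S ψ = expVal T ψ) : S = T := by
  apply ContinuousLinearMap.coe_injective
  rw [← ext_inner_map]
  intro ψ
  have hS' := (isPositive_iff_complex S).1 hS ψ
  have hT' := (isPositive_iff_complex T).1 hT ψ
  have h1 := (ENNReal.ofReal_eq_ofReal_iff (hS.re_inner_nonneg_right ψ)
    (hT.re_inner_nonneg_right ψ)).1 (h ψ)
  have h2 : RCLike.re (inner ℂ (S ψ) ψ) = RCLike.re (inner ℂ (T ψ) ψ) := by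
    rw [inner_re_symm, inner_re_symm (T ψ)]; exact h1
  exact hS'.1.symm.trans ((congrArg _ h2).trans hT'.1)

/-! ### Relabelling -/

/-- The relabelling unitary as a continuous linear map. -/
def relabelL (e : X ≃ Y) : Ell2 X →L[ℂ] Ell2 Y := (relabel e).toContinuousLinearEquiv

theorem relabelL_apply (e : X ≃ Y) (ψ : Ell2 X) (y : Y) : relabelL e ψ y = ψ (e.symm y) := rfl

theorem norm_relabelL (e : X ≃ Y) (ψ : Ell2 X) : ‖relabelL e ψ‖ = ‖ψ‖ := (relabel e).norm_map ψ

theorem adjoint_relabelL (e : X ≃ Y) : adjoint (relabelL e) = relabelL e.symm :=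
  (relabel e).adjoint_eq_symm

theorem relabelOp_eq_conj (e : X ≃ Y) (T : Op X) : relabelOp e T = conj (relabelL e) T := by
  rw [conj, adjoint_relabelL]
  rfl

theorem relabelL_ket (e : X ≃ Y) (x : X) : relabelL e (ket x) = ket (e x) := by
  ext y
  rw [relabelL_apply]
  by_cases h : y = e x
  · subst h; rw [e.symm_apply_apply, ket_apply_self, ket_apply_self]
  · rw [ket_apply_ne h, ket_apply_ne fun h' => h (by rw [← h', e.apply_symm_apply])]

theorem relabelOp_ket (e : X ≃ Y) (T : Op X) (y y' : Y) :
    relabelOp e T (ket y) y' = T (ket (e.symm y)) (e.symm y') := by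
  change T (relabelL e.symm (ket y)) (e.symm y') = _
  rw [relabelL_ket]

theorem relabelOp_mul (e : X ≃ Y) (S T : Op X) :
    relabelOp e (S * T) = relabelOp e S * relabelOp e T := by
  ext ψ y
  change S (T (relabelL e.symm ψ)) (e.symm y) =
    S ((relabel e).symm (relabel e (T (relabelL e.symm ψ)))) (e.symm y)
  rw [LinearIsometryEquiv.symm_apply_apply]

theorem relabelOp_one (e : X ≃ Y) : relabelOp e 1 = 1 := by
  ext ψ y
  exact congrArg ψ (e.apply_symm_apply y)

theorem relabelOp_add (e : X ≃ Y) (S T : Op X) :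
    relabelOp e (S + T) = relabelOp e S + relabelOp e T := by
  simp only [relabelOp_eq_conj, conj_add]

theorem adjoint_relabelOp (e : X ≃ Y) (T : Op X) :
    adjoint (relabelOp e T) = relabelOp e (adjoint T) := by
  simp only [relabelOp_eq_conj, conj, adjoint_comp, adjoint_adjoint]
  rfl

theorem trE_relabelOp (e : X ≃ Y) {T : Op X} (hT : T.IsPositive) : trE (relabelOp e T) = trE T := by
  rw [relabelOp_eq_conj, trE_conj_isometry (norm_relabelL e) hT]

theorem IsPositive.relabelOp (e : X ≃ Y) {T : Op X} (hT : T.IsPositive) :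
    (QRHL.relabelOp e T).IsPositive := by
  rw [relabelOp_eq_conj]; exact IsPositive.conj hT _

theorem IsMixed.relabelOp (e : X ≃ Y) {T : Op X} (hT : IsMixed T) :
    IsMixed (QRHL.relabelOp e T) := by
  rw [relabelOp_eq_conj]; exact hT.conj _

theorem relabelOp_conj (e : X ≃ Y) (K T : Op X) :
    relabelOp e (conj K T) = conj (relabelOp e K) (relabelOp e T) := by
  have h : conj K T = K * T * adjoint K := rfl
  rw [h, relabelOp_mul, relabelOp_mul, ← adjoint_relabelOp]
  rfl

/-! ### Slices and tensor products -/

theorem ext_slice {φ ψ : Ell2 (X × Y)} (h : ∀ y, slice y φ = slice y ψ) : φ = ψ := by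
  ext ⟨x, y⟩
  exact congrArg (fun χ : Ell2 X => χ x) (h y)

theorem adjoint_slice_ket (x : X) (y : Y) : adjoint (slice y) (ket x) = ket (x, y) := by
  refine ext_inner_right ℂ fun ψ => ?_
  rw [adjoint_inner_left, inner_ket, inner_ket, slice_apply]

theorem slice_ket_self (x : X) (y : Y) : slice y (ket (x, y)) = ket x := by
  ext x'
  rw [slice_apply]
  by_cases h : x' = x
  · subst h; rw [ket_apply_self, ket_apply_self]
  · rw [ket_apply_ne h, ket_apply_ne (by simp [h])]

theorem slice_ket_ne {y y' : Y} (h : y' ≠ y) (x : X) : slice y' (ket (x, y)) = 0 := by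
  ext x'
  rw [slice_apply, ket_apply_ne (by simp [h])]
  rfl

theorem slice_comp_adjoint_self (y : Y) : slice y ∘L adjoint (slice y) = (1 : Op X) :=
  ext_ket fun x => by rw [comp_apply, adjoint_slice_ket, slice_ket_self]; rfl

theorem slice_comp_adjoint_ne {y y' : Y} (h : y' ≠ y) :
    slice y' ∘L adjoint (slice y) = (0 : Op X) :=
  ext_ket fun x => by rw [comp_apply, adjoint_slice_ket, slice_ket_ne h]; rfl

theorem tensorId_mul (A B : Op X) : tensorId Y (A * B) = tensorId Y A * tensorId Y B := rfl

theorem tensorId_one : tensorId Y (1 : Op X) = 1 := rfl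

theorem tensorId_add (A B : Op X) : tensorId Y (A + B) = tensorId Y A + tensorId Y B := rfl

theorem tensorId_comp_adjoint_slice (A : Op X) (y : Y) :
    tensorId Y A ∘L adjoint (slice y) = adjoint (slice y) ∘L A := by
  ext1 φ
  refine ext_slice fun y' => ?_
  change A ((slice y' ∘L adjoint (slice y)) φ) = (slice y' ∘L adjoint (slice y)) (A φ)
  by_cases h : y' = y
  · subst h; rw [slice_comp_adjoint_self]; rfl
  · rw [slice_comp_adjoint_ne h]; exact map_zero A

theorem adjoint_tensorId (A : Op X) : adjoint (tensorId Y A) = tensorId Y (adjoint A) := by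
  ext1 ψ
  refine ext_slice fun y => ?_
  have h := congrArg adjoint (tensorId_comp_adjoint_slice A y)
  rw [adjoint_comp, adjoint_comp, adjoint_adjoint] at h
  exact congrArg (fun L : Ell2 (X × Y) →L[ℂ] Ell2 X => L ψ) h

theorem idTensor_mul (A B : Op Y) : idTensor X (A * B) = idTensor X A * idTensor X B := by
  rw [idTensor, tensorId_mul, relabelOp_mul]; rfl

theorem idTensor_one : idTensor X (1 : Op Y) = 1 := by
  rw [idTensor, tensorId_one, relabelOp_one]

theorem idTensor_add (A B : Op Y) : idTensor X (A + B) = idTensor X A + idTensor X B := by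
  rw [idTensor, tensorId_add, relabelOp_add]; rfl

theorem adjoint_idTensor (A : Op Y) : adjoint (idTensor X A) = idTensor X (adjoint A) := by
  rw [idTensor, adjoint_relabelOp, adjoint_tensorId]; rfl

theorem tensorId_ket_self (A : Op X) (x x' : X) (y : Y) :
    tensorId Y A (ket (x, y)) (x', y) = A (ket x) x' := by
  change A (slice y (ket (x, y))) x' = _
  rw [slice_ket_self]

theorem tensorId_ket_ne (A : Op X) (x x' : X) {y y' : Y} (h : y' ≠ y) :
    tensorId Y A (ket (x, y)) (x', y') = 0 := by
  change A (slice y' (ket (x, y))) x' = _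
  rw [slice_ket_ne h, map_zero]; rfl

theorem idTensor_ket_self (B : Op Y) (x : X) (y y' : Y) :
    idTensor X B (ket (x, y)) (x, y') = B (ket y) y' := by
  rw [idTensor, relabelOp_ket]
  exact tensorId_ket_self B y y' x

theorem idTensor_ket_ne (B : Op Y) {x x' : X} (h : x' ≠ x) (y y' : Y) :
    idTensor X B (ket (x, y)) (x', y') = 0 := by
  rw [idTensor, relabelOp_ket]
  exact tensorId_ket_ne B y y' h

theorem slice_idTensor_ket (B : Op Y) (x : X) (y y' : Y) :
    slice y' (idTensor X B (ket (x, y))) = B (ket y) y' • ket x := by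
  ext x'
  rw [slice_apply]
  change _ = B (ket y) y' * (ket x : Ell2 X) x'
  by_cases h : x' = x
  · subst h; rw [idTensor_ket_self, ket_apply_self, mul_one]
  · rw [idTensor_ket_ne B h, ket_apply_ne h, mul_zero]

theorem slice_swap_tensorId_ket (A : Op X) (x x' : X) (y : Y) :
    slice x' (relabelL (Equiv.prodComm X Y) (tensorId Y A (ket (x, y)))) =
      A (ket x) x' • ket y := by
  ext y'
  change tensorId Y A (ket (x, y)) (x', y') = A (ket x) x' * (ket y : Ell2 Y) y'
  by_cases h : y' = y
  · subst h; rw [tensorId_ket_self, ket_apply_self, mul_one]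
  · rw [tensorId_ket_ne A x x' h, ket_apply_ne h, mul_zero]

theorem tensorOp_ket (A : Op X) (B : Op Y) (x x' : X) (y y' : Y) :
    tensorOp A B (ket (x, y)) (x', y') = A (ket x) x' * B (ket y) y' := by
  change A (slice y' (idTensor X B (ket (x, y)))) x' = _
  rw [slice_idTensor_ket, map_smul]
  exact mul_comm _ _

/-- Operators on different factors commute: both orders have the product matrix entries. -/
theorem tensorOp_eq_idTensor_mul (A : Op X) (B : Op Y) :
    tensorOp A B = idTensor X B * tensorId Y A := by
  refine ext_ket fun p => ?_
  ext q
  obtain ⟨x, y⟩ := p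
  obtain ⟨x', y'⟩ := q
  rw [tensorOp_ket]
  change _ = B (slice x' (relabelL (Equiv.prodComm X Y) (tensorId Y A (ket (x, y))))) y'
  rw [slice_swap_tensorId_ket, map_smul]
  rfl

theorem tensorOp_mul (A C : Op X) (B D : Op Y) :
    tensorOp (A * C) (B * D) = tensorOp A B * tensorOp C D := by
  have h : idTensor X B * tensorId Y C = tensorId Y C * idTensor X B :=
    (tensorOp_eq_idTensor_mul C B).symm
  rw [tensorOp, tensorId_mul, idTensor_mul, tensorOp, tensorOp, mul_assoc, mul_assoc,
    ← mul_assoc (idTensor X B), h, mul_assoc]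

theorem adjoint_tensorOp (A : Op X) (B : Op Y) :
    adjoint (tensorOp A B) = tensorOp (adjoint A) (adjoint B) := by
  have h : adjoint (tensorOp A B) = adjoint (idTensor X B) * adjoint (tensorId Y A) :=
    adjoint_comp _ _
  rw [h, adjoint_idTensor, adjoint_tensorId, tensorOp_eq_idTensor_mul]

theorem conj_tensorOp (K A : Op X) (L B : Op Y) :
    conj (tensorOp K L) (tensorOp A B) = tensorOp (conj K A) (conj L B) := by
  have h1 : conj K A = K * (A * adjoint K) := rfl
  have h2 : conj L B = L * (B * adjoint L) := rfl
  rw [h1, h2, tensorOp_mul, tensorOp_mul, ← adjoint_tensorOp]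
  rfl

theorem IsPositive.tensorOp {A : Op X} {B : Op Y} (hA : A.IsPositive) (hB : B.IsPositive) :
    (QRHL.tensorOp A B).IsPositive := by
  obtain ⟨C, rfl⟩ := exists_adjoint_comp_self hA
  obtain ⟨D, rfl⟩ := exists_adjoint_comp_self hB
  have h := tensorOp_mul (adjoint C) C (adjoint D) D
  rw [← adjoint_tensorOp] at h
  change QRHL.tensorOp (adjoint C ∘L C) (adjoint D ∘L D) = _ at h
  rw [h]
  exact isPositive_adjoint_comp_self _

theorem tensorOp_add_right (A : Op X) (B C : Op Y) :
    tensorOp A (B + C) = tensorOp A B + tensorOp A C := by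
  rw [tensorOp, idTensor_add, mul_add]; rfl

theorem expVal_ket (T : Op X) (x : X) : expVal T (ket x) = ENNReal.ofReal (T (ket x) x).re := by
  rw [expVal, inner_ket]

theorem coe_re_ket {T : Op X} (hT : T.IsPositive) (x : X) : ((T (ket x) x).re : ℂ) = T (ket x) x := by
  have h := (isPositive_iff_complex T).1 hT (ket x)
  rw [← inner_conj_symm, inner_ket] at h
  have h1 := congrArg (starRingEnd ℂ) h.1
  simpa using h1

theorem re_ket_nonneg {T : Op X} (hT : T.IsPositive) (x : X) : 0 ≤ (T (ket x) x).re := by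
  have h := hT.re_inner_nonneg_right (ket x)
  rwa [inner_ket] at h

theorem trE_tensorOp {A : Op X} {B : Op Y} (hA : A.IsPositive) (hB : B.IsPositive) :
    trE (tensorOp A B) = trE A * trE B := by
  simp only [trE, expVal_ket]
  rw [← ENNReal.tsum_mul_right]
  simp only [← ENNReal.tsum_mul_left]
  rw [← ENNReal.tsum_prod]
  refine tsum_congr fun ⟨x, y⟩ => ?_
  -- Positivity makes the diagonal entries real, so taking real parts is multiplicative here.
  rw [tensorOp_ket, ← coe_re_ket hA, ← coe_re_ket hB, ← Complex.ofReal_mul, Complex.ofReal_re,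
    ENNReal.ofReal_mul (re_ket_nonneg hA x), Complex.ofReal_re, Complex.ofReal_re]

theorem IsMixed.tensorOp {A : Op X} {B : Op Y} (hA : IsMixed A) (hB : IsMixed B) :
    IsMixed (QRHL.tensorOp A B) :=
  isMixed_iff.2 ⟨IsPositive.tensorOp hA.pos hB.pos, by
    rw [trE_tensorOp hA.pos hB.pos]
    exact ENNReal.mul_ne_top hA.trE_ne_top hB.trE_ne_top⟩

theorem relabelOp_prodComm_tensorOp (A : Op X) (B : Op Y) :
    relabelOp (Equiv.prodComm X Y) (tensorOp A B) = tensorOp B A := by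
  refine ext_ket fun p => ?_
  ext q
  obtain ⟨y, x⟩ := p
  obtain ⟨y', x'⟩ := q
  rw [relabelOp_ket, tensorOp_ket]
  rw [tensorOp_ket, mul_comm]; rfl

/-! ### Partial traces -/

theorem slice_conj_pos {ρ : Op (X × Y)} (hρ : ρ.IsPositive) (y : Y) :
    (conj (slice y) ρ).IsPositive := IsPositive.conj hρ _

theorem tsum_trE_slice (ρ : Op (X × Y)) : ∑' y, trE (conj (slice (X := X) y) ρ) = trE ρ := by
  simp only [trE, expVal_conj, adjoint_slice_ket]
  rw [ENNReal.tsum_comm, ← ENNReal.tsum_prod]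

/-- Rules out the default value `0` of `∑'`: the slices are positive with total trace `trE ρ`, which
is finite. -/
theorem hasSum_ptraceSnd {ρ : Op (X × Y)} (hρ : IsMixed ρ) :
    HasSum (fun y => conj (slice y) ρ) (ptraceSnd ρ) :=
  (summable_of_tsum_trE (fun y => slice_conj_pos hρ.pos y)
    (by rw [tsum_trE_slice]; exact hρ.trE_ne_top)).hasSum

theorem trE_ptraceSnd {ρ : Op (X × Y)} (hρ : IsMixed ρ) : trE (ptraceSnd ρ) = trE ρ := by
  rw [trE_hasSum (hasSum_ptraceSnd hρ) (slice_conj_pos hρ.pos), tsum_trE_slice]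

theorem IsMixed.ptraceSnd {ρ : Op (X × Y)} (hρ : IsMixed ρ) : IsMixed (QRHL.ptraceSnd ρ) :=
  isMixed_iff.2 ⟨isPositive_of_hasSum (hasSum_ptraceSnd hρ) (slice_conj_pos hρ.pos), by
    rw [trE_ptraceSnd hρ]; exact hρ.trE_ne_top⟩

theorem ptraceSnd_add {ρ σ : Op (X × Y)} (hρ : IsMixed ρ) (hσ : IsMixed σ) :
    ptraceSnd (ρ + σ) = ptraceSnd ρ + ptraceSnd σ := by
  refine (hasSum_ptraceSnd (hρ.add hσ)).unique ?_
  simpa only [conj_add] using (hasSum_ptraceSnd hρ).add (hasSum_ptraceSnd hσ)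

theorem trE_ptraceFst {ρ : Op (X × Y)} (hρ : IsMixed ρ) : trE (ptraceFst ρ) = trE ρ := by
  rw [ptraceFst, trE_ptraceSnd (hρ.relabelOp _), trE_relabelOp _ hρ.pos]

theorem IsMixed.ptraceFst {ρ : Op (X × Y)} (hρ : IsMixed ρ) : IsMixed (QRHL.ptraceFst ρ) :=
  (hρ.relabelOp _).ptraceSnd

theorem ptraceFst_add {ρ σ : Op (X × Y)} (hρ : IsMixed ρ) (hσ : IsMixed σ) :
    ptraceFst (ρ + σ) = ptraceFst ρ + ptraceFst σ := by
  rw [ptraceFst, relabelOp_add, ptraceSnd_add (hρ.relabelOp _) (hσ.relabelOp _)]; rfl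

theorem ptraceSnd_conj_tensorId {ρ : Op (X × Y)} (hρ : IsMixed ρ) (K : Op X) :
    ptraceSnd (conj (tensorId Y K) ρ) = conj K (ptraceSnd ρ) := by
  refine (hasSum_ptraceSnd (hρ.conj _)).unique ?_
  convert hasSum_conj K (hasSum_ptraceSnd hρ) using 2 with y
  rw [conj_conj, conj_conj]
  rfl

/-- Expresses an expectation value as a trace, so that equality of operators can be tested by traces
alone. -/
theorem trE_conj_rankOne (φ : Ell2 X) (T : Op X) :
    trE (conj (proj φ) T) = ENNReal.ofReal (‖φ‖ ^ 2) * expVal T φ := by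
  rw [ofReal_norm_sq, ← ENNReal.tsum_mul_right, trE]
  refine tsum_congr fun x => ?_
  have h : adjoint (proj φ) (ket x) = inner ℂ φ (ket x) • φ := by
    rw [proj, InnerProductSpace.adjoint_rankOne, InnerProductSpace.rankOne_apply]
  rw [expVal_conj, h, ← inner_ket, ← norm_inner_symm]
  simp only [expVal, map_smul, inner_smul_left, inner_smul_right]
  rw [← mul_assoc, Complex.mul_conj, Complex.re_ofReal_mul,
    ENNReal.ofReal_mul (Complex.normSq_nonneg _), Complex.normSq_eq_norm_sq]

/-- No signalling: testing against `|φ⟩⟨φ|` on the first factor commutes with measuring the second,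
and a complete measurement preserves the total trace. -/
theorem ptraceSnd_conj_idTensor_add {ρ : Op (X × Y)} (hρ : IsMixed ρ) {K L : Op Y}
    (h : adjoint K * K + adjoint L * L = 1) :
    ptraceSnd (conj (idTensor X K) ρ) + ptraceSnd (conj (idTensor X L) ρ) = ptraceSnd ρ := by
  have hK := (hρ.conj (idTensor X K)).ptraceSnd
  have hL := (hρ.conj (idTensor X L)).ptraceSnd
  refine eq_of_expVal_eq (hK.add hL).pos hρ.ptraceSnd.pos fun φ => ?_
  by_cases hφ : φ = 0
  · subst hφ; simp [expVal]
  have hn : ENNReal.ofReal (‖φ‖ ^ 2) ≠ 0 := by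
    simpa using hφ
  rw [← ENNReal.mul_right_inj hn ENNReal.ofReal_ne_top, ← trE_conj_rankOne, ← trE_conj_rankOne,
    conj_add, trE_add (hK.conj _).pos (hL.conj _).pos]
  have key : ∀ N : Op Y, trE (conj (proj φ) (ptraceSnd (conj (idTensor X N) ρ))) =
      trE (conj (idTensor X N) (conj (tensorId Y (proj φ)) ρ)) := by
    intro N
    rw [← ptraceSnd_conj_tensorId (hρ.conj _), trE_ptraceSnd ((hρ.conj _).conj _), conj_conj,
      conj_conj]
    exact congrArg (fun S => trE (conj S ρ)) (tensorOp_eq_idTensor_mul (proj φ) N)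
  rw [key, key, ← ptraceSnd_conj_tensorId hρ, trE_ptraceSnd (hρ.conj _),
    trE_conj_add_trE_conj _ (hρ.conj _).pos]
  rw [adjoint_idTensor, adjoint_idTensor, ← idTensor_mul, ← idTensor_mul, ← idTensor_add, h,
    idTensor_one]

theorem ptraceSnd_tensorOp {A : Op X} {B : Op Y} (hA : IsMixed A) (hB : IsMixed B) :
    ptraceSnd (tensorOp A B) = ((trE B).toReal : ℂ) • A := by
  refine (hasSum_ptraceSnd (hA.tensorOp hB)).unique ?_
  have h1 : HasSum (fun y => ((B (ket y) y).re : ℂ)) ((trE B).toReal : ℂ) := by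
    have h2 := ENNReal.hasSum_toReal hB.trE_ne_top
    rw [← ENNReal.tsum_toReal_eq (ENNReal.ne_top_of_tsum_ne_top hB.trE_ne_top)] at h2
    have h3 : HasSum (fun y => (B (ket y) y).re) (trE B).toReal := by
      refine h2.congr_fun fun y => ?_
      rw [expVal_ket, ENNReal.toReal_ofReal (re_ket_nonneg hB.pos y)]
    exact h3.mapL Complex.ofRealCLM
  convert h1.smul_const A using 2 with y
  refine ext_ket fun x => ?_
  ext x'
  rw [coe_re_ket hB.pos]
  change tensorOp A B (adjoint (slice y) (ket x)) (x', y) = B (ket y) y * A (ket x) x'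
  rw [adjoint_slice_ket, tensorOp_ket, mul_comm]

theorem ptraceFst_tensorOp {A : Op X} {B : Op Y} (hA : IsMixed A) (hB : IsMixed B) :
    ptraceFst (tensorOp A B) = ((trE A).toReal : ℂ) • B := by
  rw [ptraceFst, relabelOp_prodComm_tensorOp, ptraceSnd_tensorOp hB hA]

/-! ### Scalar multiples -/

theorem trE_smul {r : ℝ} (hr : 0 ≤ r) (T : Op X) : trE ((r : ℂ) • T) = ENNReal.ofReal r * trE T := by
  rw [trE, trE, ← ENNReal.tsum_mul_left]
  refine tsum_congr fun x => ?_
  rw [expVal_ket, expVal_ket, ← ENNReal.ofReal_mul hr, ← Complex.re_ofReal_mul]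
  rfl

theorem IsMixed.smul {r : ℝ} (hr : 0 ≤ r) {ρ : Op X} (hρ : IsMixed ρ) : IsMixed ((r : ℂ) • ρ) :=
  isMixed_iff.2 ⟨hρ.pos.smul_of_nonneg (by exact_mod_cast hr), by
    rw [trE_smul hr]; exact ENNReal.mul_ne_top ENNReal.ofReal_ne_top hρ.trE_ne_top⟩

theorem IsMixed.eq_zero {ρ : Op X} (hρ : IsMixed ρ) (h : trE ρ = 0) : ρ = 0 := by
  have h1 := ofReal_norm_le_trE hρ.pos
  rw [h, nonpos_iff_eq_zero, ENNReal.ofReal_eq_zero] at h1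
  exact norm_le_zero_iff.1 h1

/-! ### Marginals of locally measured states -/

theorem ptraceSnd_conj_tensorOp_add {ρ : Op (X × Y)} (hρ : IsMixed ρ) (K : Op X) {L₁ L₂ : Op Y}
    (h : adjoint L₁ * L₁ + adjoint L₂ * L₂ = 1) :
    ptraceSnd (conj (tensorOp K L₁) ρ) + ptraceSnd (conj (tensorOp K L₂) ρ) =
      conj K (ptraceSnd ρ) := by
  have key (L : Op Y) : ptraceSnd (conj (tensorOp K L) ρ) =
      conj K (ptraceSnd (conj (idTensor X L) ρ)) := by
    rw [← ptraceSnd_conj_tensorId (hρ.conj _), conj_conj]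
    rfl
  rw [key, key, ← conj_add, ptraceSnd_conj_idTensor_add hρ h]

theorem ptraceFst_conj_tensorOp_add {ρ : Op (X × Y)} (hρ : IsMixed ρ) {K₁ K₂ : Op X} (L : Op Y)
    (h : adjoint K₁ * K₁ + adjoint K₂ * K₂ = 1) :
    ptraceFst (conj (tensorOp K₁ L) ρ) + ptraceFst (conj (tensorOp K₂ L) ρ) =
      conj L (ptraceFst ρ) := by
  simp only [ptraceFst, relabelOp_conj, relabelOp_prodComm_tensorOp]
  exact ptraceSnd_conj_tensorOp_add (hρ.relabelOp _) L h

/-! ### Separable states -/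

/-- Product terms are positive, so operator-norm convergence to a mixed state already gives
trace-norm convergence. -/
theorem isSeparable_of_hasSum {ι : Type} {ρ : Op (X × Y)} (hρ : IsMixed ρ) {ρ₁ : ι → Op X}
    {ρ₂ : ι → Op Y} (h₁ : ∀ i, IsMixed (ρ₁ i)) (h₂ : ∀ i, IsMixed (ρ₂ i))
    (h : HasSum (fun i => tensorOp (ρ₁ i) (ρ₂ i)) ρ) : IsSeparable ρ :=
  ⟨hρ, ι, ρ₁, ρ₂, h₁, h₂, hasTraceSum_of_hasSum h
    (fun i => IsPositive.tensorOp (h₁ i).pos (h₂ i).pos) hρ.trE_ne_top⟩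

theorem IsSeparable.conj {ρ : Op (X × Y)} (hρ : IsSeparable ρ) (K : Op X) (L : Op Y) :
    IsSeparable (QRHL.conj (tensorOp K L) ρ) := by
  obtain ⟨hm, ι, ρ₁, ρ₂, h₁, h₂, h⟩ := hρ
  refine isSeparable_of_hasSum (hm.conj _) (fun i => (h₁ i).conj K) (fun i => (h₂ i).conj L) ?_
  simpa only [conj_tensorOp] using hasSum_conj (tensorOp K L) (hasSum_of_hasTraceSum h)

theorem IsSeparable.add {ρ σ : Op (X × Y)} (hρ : IsSeparable ρ) (hσ : IsSeparable σ) :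
    IsSeparable (ρ + σ) := by
  obtain ⟨hm, ι, ρ₁, ρ₂, h₁, h₂, h⟩ := hρ
  obtain ⟨hm', ι', σ₁, σ₂, h₁', h₂', h'⟩ := hσ
  refine isSeparable_of_hasSum (ι := ι ⊕ ι') (ρ₁ := Sum.elim ρ₁ σ₁) (ρ₂ := Sum.elim ρ₂ σ₂)
    (hm.add hm') ?_ ?_ ?_
  · rintro (i | i)
    exacts [h₁ i, h₁' i]
  · rintro (i | i)
    exacts [h₂ i, h₂' i]
  · exact HasSum.sum (hasSum_of_hasTraceSum h) (hasSum_of_hasTraceSum h')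

theorem IsMixed.isSeparable_tensorOp {A : Op X} {B : Op Y} (hA : IsMixed A) (hB : IsMixed B) :
    IsSeparable (QRHL.tensorOp A B) :=
  isSeparable_of_hasSum (ι := Unit) (hA.tensorOp hB) (fun _ => hA) (fun _ => hB)
    (hasSum_unique fun _ : Unit => QRHL.tensorOp A B)

/-! ### Quantum operations -/

/-- Additive, trace-nonincreasing maps on mixed states. -/
structure IsQuantumOp (F : Op X → Op X) : Prop where
  mixed : ∀ {ρ}, IsMixed ρ → IsMixed (F ρ)
  trE_le : ∀ {ρ}, IsMixed ρ → trE (F ρ) ≤ trE ρ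
  add : ∀ {ρ σ}, IsMixed ρ → IsMixed σ → F (ρ + σ) = F ρ + F σ

theorem IsQuantumOp.conj_isometry {K : Op X} (hK : ∀ ψ, ‖K ψ‖ = ‖ψ‖) : IsQuantumOp (conj K) where
  mixed h := h.conj K
  trE_le h := (trE_conj_isometry hK h.pos).le
  add _ _ := conj_add K _ _

theorem IsQuantumOp.comp {F G : Op X → Op X} (hF : IsQuantumOp F) (hG : IsQuantumOp G) :
    IsQuantumOp fun ρ => G (F ρ) where
  mixed h := hG.mixed (hF.mixed h)
  trE_le h := (hG.trE_le (hF.mixed h)).trans (hF.trE_le h)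
  add h h' := by rw [hF.add h h', hG.add (hF.mixed h) (hF.mixed h')]

theorem IsQuantumOp.ifte {F G : Op X → Op X} (hF : IsQuantumOp F) (hG : IsQuantumOp G) {K L : Op X}
    (h : adjoint K * K + adjoint L * L = 1) :
    IsQuantumOp fun ρ => F (conj K ρ) + G (conj L ρ) where
  mixed hρ := (hF.mixed (hρ.conj K)).add (hG.mixed (hρ.conj L))
  trE_le hρ := by
    rw [trE_add (hF.mixed (hρ.conj K)).pos (hG.mixed (hρ.conj L)).pos,
      ← trE_conj_add_trE_conj h hρ.pos]
    exact add_le_add (hF.trE_le (hρ.conj K)) (hG.trE_le (hρ.conj L))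
  add hρ hσ := by
    rw [conj_add, conj_add, hF.add (hρ.conj K) (hσ.conj K), hG.add (hρ.conj L) (hσ.conj L)]
    exact add_add_add_comm _ _ _ _

/-! ### While loops: trace accounting over the iterations -/

section Loop

variable {F : Op X → Op X} {K L : Op X}

theorem IsQuantumOp.iterate_mixed (hF : IsQuantumOp F) {ρ : Op X} (hρ : IsMixed ρ) (n : ℕ) :
    IsMixed ((fun σ => F (conj K σ))^[n] ρ) := by
  induction n with
  | zero => exact hρ
  | succ n ih =>
    rw [Function.iterate_succ_apply']
    exact hF.mixed (ih.conj K)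

theorem IsQuantumOp.iterate_add (hF : IsQuantumOp F) {ρ σ : Op X} (hρ : IsMixed ρ)
    (hσ : IsMixed σ) (n : ℕ) :
    (fun τ => F (conj K τ))^[n] (ρ + σ) =
      (fun τ => F (conj K τ))^[n] ρ + (fun τ => F (conj K τ))^[n] σ := by
  induction n with
  | zero => rfl
  | succ n ih =>
    rw [Function.iterate_succ_apply', Function.iterate_succ_apply', Function.iterate_succ_apply', ih,
      conj_add, hF.add ((hF.iterate_mixed hρ n).conj K) ((hF.iterate_mixed hσ n).conj K)]

/-- Loop invariant: the trace that has left within `k` rounds plus the trace still inside. Each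
round splits the inside part by the measurement, and `F` cannot increase the part that continues. -/
theorem IsQuantumOp.sum_trE_iterate_le (hF : IsQuantumOp F)
    (h : adjoint K * K + adjoint L * L = 1) {ρ : Op X} (hρ : IsMixed ρ) (k : ℕ) :
    ∑ n ∈ Finset.range k, trE (conj L ((fun σ => F (conj K σ))^[n] ρ)) +
      trE ((fun σ => F (conj K σ))^[k] ρ) ≤ trE ρ := by
  induction k with
  | zero => simp
  | succ k ih =>
    refine le_trans ?_ ih
    rw [Finset.sum_range_succ, add_assoc]
    refine add_le_add_right ?_ _
    have hk := hF.iterate_mixed (K := K) hρ k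
    rw [Function.iterate_succ_apply', ← trE_conj_add_trE_conj h hk.pos, add_comm]
    exact add_le_add_left (hF.trE_le (hk.conj K)) _

theorem IsQuantumOp.tsum_trE_iterate_le (hF : IsQuantumOp F)
    (h : adjoint K * K + adjoint L * L = 1) {ρ : Op X} (hρ : IsMixed ρ) :
    ∑' n, trE (conj L ((fun σ => F (conj K σ))^[n] ρ)) ≤ trE ρ := by
  rw [ENNReal.tsum_eq_iSup_nat]
  exact iSup_le fun k => le_self_add.trans (hF.sum_trE_iterate_le h hρ k)

theorem IsQuantumOp.hasSum_iterate (hF : IsQuantumOp F)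
    (h : adjoint K * K + adjoint L * L = 1) {ρ : Op X} (hρ : IsMixed ρ) :
    HasSum (fun n => conj L ((fun σ => F (conj K σ))^[n] ρ))
      (∑' n, conj L ((fun σ => F (conj K σ))^[n] ρ)) :=
  (summable_of_tsum_trE (fun n => ((hF.iterate_mixed hρ n).conj L).pos)
    (ne_top_of_le_ne_top hρ.trE_ne_top (hF.tsum_trE_iterate_le h hρ))).hasSum

theorem IsQuantumOp.while (hF : IsQuantumOp F) (h : adjoint K * K + adjoint L * L = 1) :
    IsQuantumOp fun ρ => ∑' n : ℕ, conj L ((fun σ => F (conj K σ))^[n] ρ) := by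
  have hle {ρ : Op X} (hρ : IsMixed ρ) :
      trE (∑' n : ℕ, conj L ((fun σ => F (conj K σ))^[n] ρ)) ≤ trE ρ := by
    rw [trE_hasSum (hF.hasSum_iterate h hρ) fun n => ((hF.iterate_mixed hρ n).conj L).pos]
    exact hF.tsum_trE_iterate_le h hρ
  refine ⟨fun hρ => isMixed_iff.2 ⟨?_, ne_top_of_le_ne_top hρ.trE_ne_top (hle hρ)⟩, hle,
    fun hρ hσ => ?_⟩
  · exact isPositive_of_hasSum (hF.hasSum_iterate h hρ)
      fun n => ((hF.iterate_mixed hρ n).conj L).pos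
  · refine (hF.hasSum_iterate h (hρ.add hσ)).unique ?_
    simpa only [hF.iterate_add hρ hσ, conj_add] using
      (hF.hasSum_iterate h hρ).add (hF.hasSum_iterate h hσ)

end Loop

/-! ### Programs -/

section Programs

variable {V : Type*} {T : V → Type*}

theorem adjoint_onVars_mul (X : Finset V) (U : Op (MemOn T X)) :
    adjoint (onVars X U) * onVars X U = onVars X (adjoint U * U) := by
  rw [onVars, adjoint_relabelOp, adjoint_tensorId, ← relabelOp_mul, ← tensorId_mul]; rfl

theorem onVars_complete (X : Finset V) (M : BinMeas (MemOn T X)) :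
    adjoint (onVars X (M.op true)) * onVars X (M.op true) +
      adjoint (onVars X (M.op false)) * onVars X (M.op false) = 1 := by
  rw [adjoint_onVars_mul, adjoint_onVars_mul, onVars, onVars, ← relabelOp_add, ← tensorId_add,
    M.complete, tensorId_one, relabelOp_one]

theorem norm_onVars_isometry (X : Finset V) (U : Ell2 (MemOn T X) →ₗᵢ[ℂ] Ell2 (MemOn T X))
    (ψ : Ell2 (Mem T)) : ‖onVars X U.toContinuousLinearMap ψ‖ = ‖ψ‖ := by
  refine (norm_map_iff_adjoint_comp_self _).2 ?_ ψ
  have h : adjoint U.toContinuousLinearMap ∘L U.toContinuousLinearMap = 1 :=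
    (norm_map_iff_adjoint_comp_self _).1 U.norm_map
  have h1 := adjoint_onVars_mul X U.toContinuousLinearMap
  have h2 : adjoint U.toContinuousLinearMap * U.toContinuousLinearMap = 1 := h
  rw [h2, onVars, onVars, tensorId_one, relabelOp_one] at h1
  exact h1

theorem isMixed_proj (ψ : Ell2 X) : IsMixed (proj ψ) ∧ trE (proj ψ) = ENNReal.ofReal (‖ψ‖ ^ 2) := by
  have h : trE (proj ψ) = ENNReal.ofReal (‖ψ‖ ^ 2) := by
    rw [ofReal_norm_sq, trE]
    refine tsum_congr fun x => ?_
    rw [expVal, proj, InnerProductSpace.rankOne_apply, inner_smul_right, inner_ket,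
      ← inner_conj_symm, inner_ket, mul_comm, Complex.mul_conj, Complex.ofReal_re,
      Complex.normSq_eq_norm_sq]
  exact ⟨isMixed_iff.2 ⟨InnerProductSpace.isPositive_rankOne_self ψ, h ▸ ENNReal.ofReal_ne_top⟩, h⟩

/-- Additivity merges the branches of a conditional; preservation of mixedness guarantees that the
partial traces and loop series involved converge. -/
theorem isQuantumOp_denot (c : Prog T) : IsQuantumOp (denot c) := by
  induction c with
  | apply X U => exact IsQuantumOp.conj_isometry (norm_onVars_isometry X U)
  | init X ψ hψ =>
    obtain ⟨hm, ht⟩ := isMixed_proj ψ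
    have hp {ρ : Op (Mem T)} (hρ : IsMixed ρ) := (hρ.relabelOp (splitMem T X)).ptraceFst
    refine ⟨fun hρ => (hm.tensorOp (hp hρ)).relabelOp _, fun hρ => ?_, fun hρ hσ => ?_⟩
    · rw [denot, trE_relabelOp _ (hm.tensorOp (hp hρ)).pos, trE_tensorOp hm.pos (hp hρ).pos, ht, hψ,
        trE_ptraceFst (hρ.relabelOp _), trE_relabelOp _ hρ.pos]
      simp
    · simp only [denot]
      rw [relabelOp_add, ptraceFst_add (hρ.relabelOp _) (hσ.relabelOp _),
        tensorOp_add_right, relabelOp_add]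
  | ifte X M c d hc hd =>
    have h := hc.ifte hd (onVars_complete X M)
    rw [denot]
    exact h
  | seq c d hc hd =>
    rw [denot]
    exact hc.comp hd
  | skip =>
    rw [denot]
    exact ⟨id, fun _ => le_rfl, fun _ _ => rfl⟩
  -- The remaining constructor is `while`.
  | _ X M c hc =>
    have h := hc.while (onVars_complete X M)
    rw [denot]
    exact h

/-! ### Judgments for conditionals -/

theorem restrictStar_eq (X : Finset V) (M : BinMeas (MemOn T X)) (Y : Finset V)
    (N : BinMeas (MemOn T Y)) (t u : Bool) (A : Op (Mem T × Mem T)) :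
    restrictStar X M Y N t u A =
      adjoint (tensorOp (onVars X (M.op t)) (onVars Y (N.op u))) ∘L A ∘L
        tensorOp (onVars X (M.op t)) (onVars Y (N.op u)) := by
  rw [tensorOp_eq_idTensor_mul]
  have h (P Q : Op (Mem T × Mem T)) : adjoint (P * Q) = adjoint Q * adjoint P := adjoint_comp _ _
  rw [h]
  rfl

theorem restrictStar_zero (X : Finset V) (M : BinMeas (MemOn T X)) (Y : Finset V)
    (N : BinMeas (MemOn T Y)) (t u : Bool) : restrictStar X M Y N t u 0 = 0 := by
  simp [restrictStar]

theorem isExpectation_restrictStar (X : Finset V) (M : BinMeas (MemOn T X)) (Y : Finset V)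
    (N : BinMeas (MemOn T Y)) (t u : Bool) {A : Op (Mem T × Mem T)} (hA : IsExpectation A) :
    IsExpectation (restrictStar X M Y N t u A) := by
  rw [restrictStar_eq]
  exact ContinuousLinearMap.IsPositive.adjoint_conj hA _

theorem rhl_ifte (X Y : Finset V) (M : BinMeas (MemOn T X)) (N : BinMeas (MemOn T Y))
    (c d : Bool → Prog T) (A : Bool → Bool → Op (Mem T × Mem T)) (B : Op (Mem T × Mem T))
    (h : ∀ t u, rhl (A t u) (c t) (d u) B) :
    rhl (∑ t, ∑ u, restrictStar X M Y N t u (A t u))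
      (.ifte X M (c true) (c false)) (.ifte Y N (d true) (d false)) B := by
  intro ρ hρ
  have hm := hρ.1
  set K : Bool → Op (Mem T) := fun t => onVars X (M.op t)
  set L : Bool → Op (Mem T) := fun u => onVars Y (N.op u)
  have hKc : adjoint (K true) * K true + adjoint (K false) * K false = 1 := onVars_complete X M
  have hLc : adjoint (L true) * L true + adjoint (L false) * L false = 1 := onVars_complete Y N
  choose ρ' hs h₁ h₂ htr using fun t u => h t u _ (hρ.conj (K t) (L u))
  have hms t u : IsMixed (ρ' t u) := (hs t u).1
  have hms' t : IsMixed (ρ' t true + ρ' t false) := (hms t true).add (hms t false)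
  have hmc t u : IsMixed (conj (tensorOp (K t) (L u)) ρ) := hm.conj _
  refine ⟨ρ' true true + ρ' true false + (ρ' false true + ρ' false false),
    ((hs _ _).add (hs _ _)).add ((hs _ _).add (hs _ _)), ?_, ?_, ?_⟩
  -- For fixed outcome `t` on the left, summing over the right outcome leaves the left marginal
  -- measured by `K t` alone.
  · have key t : denot (c t) (ptraceSnd (conj (tensorOp (K t) (L true)) ρ)) +
        denot (c t) (ptraceSnd (conj (tensorOp (K t) (L false)) ρ)) =
        denot (c t) (conj (K t) (ptraceSnd ρ)) := by
      rw [← (isQuantumOp_denot (c t)).add (hmc _ _).ptraceSnd (hmc _ _).ptraceSnd,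
        ptraceSnd_conj_tensorOp_add hm (K t) hLc]
    rw [ptraceSnd_add (hms' true) (hms' false), ptraceSnd_add (hms _ _) (hms _ _),
      ptraceSnd_add (hms _ _) (hms _ _), h₁, h₁, h₁, h₁, key, key]
    rfl
  -- Symmetrically for fixed `u`; the four terms are grouped by `t`, hence the regrouping with
  -- `add_add_add_comm`.
  · have key u : denot (d u) (ptraceFst (conj (tensorOp (K true) (L u)) ρ)) +
        denot (d u) (ptraceFst (conj (tensorOp (K false) (L u)) ρ)) =
        denot (d u) (conj (L u) (ptraceFst ρ)) := by
      rw [← (isQuantumOp_denot (d u)).add (hmc _ _).ptraceFst (hmc _ _).ptraceFst,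
        ptraceFst_conj_tensorOp_add hm (L u) hKc]
    rw [ptraceFst_add (hms' true) (hms' false), ptraceFst_add (hms _ _) (hms _ _),
      ptraceFst_add (hms _ _) (hms _ _), h₂, h₂, h₂, h₂, add_add_add_comm, key, key]
    rfl
  · have key t u : tr (restrictStar X M Y N t u (A t u) * ρ) =
        tr (A t u * conj (tensorOp (K t) (L u)) ρ) := by
      rw [restrictStar_eq, tr_mul_conj hm]
    simp only [Fintype.sum_bool]
    rw [tr_add_mul hm, tr_add_mul hm, tr_add_mul hm, key, key, key, key,
      tr_mul_add (hms' true) (hms' false), tr_mul_add (hms _ _) (hms _ _),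
      tr_mul_add (hms _ _) (hms _ _)]
    exact add_le_add (add_le_add (htr _ _) (htr _ _)) (add_le_add (htr _ _) (htr _ _))

theorem Prog.Terminating.trE_denot {c : Prog T} (hc : c.Terminating) {ρ : Op (Mem T)}
    (hρ : IsMixed ρ) : trE (denot c ρ) = trE ρ := by
  rw [← ((isQuantumOp_denot c).mixed hρ).ofReal_tr, hc ρ hρ, hρ.ofReal_tr]

/-- Termination gives both outputs the trace `a = tr ρ`, so `a⁻¹ • (σ ⊗ τ)` has marginals `σ` and
`τ`. The trace inequality only needs `0 ≤ tr (B ρ')`. -/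
theorem rhl_zero {c d : Prog T} (hc : c.Terminating) (hd : d.Terminating)
    {B : Op (Mem T × Mem T)} (hB : IsExpectation B) : rhl 0 c d B := by
  intro ρ hρ
  have hm := hρ.1
  have hσ := (isQuantumOp_denot c).mixed hm.ptraceSnd
  have hτ := (isQuantumOp_denot d).mixed hm.ptraceFst
  have htσ : trE (denot c (ptraceSnd ρ)) = trE ρ := by
    rw [hc.trE_denot hm.ptraceSnd, trE_ptraceSnd hm]
  have htτ : trE (denot d (ptraceFst ρ)) = trE ρ := by
    rw [hd.trE_denot hm.ptraceFst, trE_ptraceFst hm]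
  set a := (trE ρ).toReal with ha
  have ha0 : 0 ≤ a⁻¹ := inv_nonneg.2 ENNReal.toReal_nonneg
  have hσ' := hσ.smul ha0
  refine ⟨_, hσ'.isSeparable_tensorOp hτ, ?_, ?_, ?_⟩
  · rw [ptraceSnd_tensorOp hσ' hτ, htτ, smul_smul, ← ha]
    -- If `a = 0`, then `a⁻¹ = 0` and the product is zero, which is still correct because both
    -- outputs vanish.
    by_cases h0 : trE ρ = 0
    · rw [hσ.eq_zero (htσ.trans h0), smul_zero]
    · have : a ≠ 0 := ENNReal.toReal_ne_zero.2 ⟨h0, hm.trE_ne_top⟩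
      rw [← Complex.ofReal_mul, mul_inv_cancel₀ this, Complex.ofReal_one, one_smul]
  · rw [ptraceFst_tensorOp hσ' hτ, trE_smul ha0, htσ, ENNReal.toReal_mul,
      ENNReal.toReal_ofReal ha0, ← ha]
    by_cases h0 : trE ρ = 0
    · rw [hτ.eq_zero (htτ.trans h0), smul_zero]
    · have : a ≠ 0 := ENNReal.toReal_ne_zero.2 ⟨h0, hm.trE_ne_top⟩
      rw [inv_mul_cancel₀ this, Complex.ofReal_one, one_smul]
  · have h0 : tr ((0 : Op (Mem T × Mem T)) * ρ) = 0 := by simp [tr]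
    rw [h0]
    exact tr_mul_nonneg hB (hσ'.tensorOp hτ)

end Programs

end QRHL

end

theorem mainTheorem6 {V : Type*} (T : V → Type*) [∀ v, Nonempty (T v)]
    (X Y : Finset V) (M : QRHL.BinMeas (QRHL.MemOn T X)) (N : QRHL.BinMeas (QRHL.MemOn T Y))
    (c d : Bool → QRHL.Prog T) (B : QRHL.Op (QRHL.Mem T × QRHL.Mem T))
    (hB : QRHL.IsExpectation B) :
    (∀ A : Bool → Bool → QRHL.Op (QRHL.Mem T × QRHL.Mem T),
      (∀ t u, QRHL.IsExpectation (A t u)) →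
      (∀ t u, QRHL.rhl (A t u) (c t) (d u) B) →
      QRHL.IsExpectation (∑ t, ∑ u, QRHL.restrictStar X M Y N t u (A t u)) ∧
      QRHL.rhl (∑ t, ∑ u, QRHL.restrictStar X M Y N t u (A t u))
        (.ifte X M (c true) (c false)) (.ifte Y N (d true) (d false)) B) ∧
    (∀ A : Bool → QRHL.Op (QRHL.Mem T × QRHL.Mem T),
      (∀ t, QRHL.IsExpectation (A t)) →
      (∀ t, (c t).Terminating) → (∀ t, (d t).Terminating) →
      (∀ t, QRHL.rhl (A t) (c t) (d t) B) →
      QRHL.IsExpectation (QRHL.restrictStar X M Y N true true (A true) +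
        QRHL.restrictStar X M Y N false false (A false)) ∧
      QRHL.rhl (QRHL.restrictStar X M Y N true true (A true) +
          QRHL.restrictStar X M Y N false false (A false))
        (.ifte X M (c true) (c false)) (.ifte Y N (d true) (d false)) B) := by
  refine ⟨fun A hA h => ⟨?_, QRHL.rhl_ifte X Y M N c d A B h⟩, fun A hA hc hd h => ⟨?_, ?_⟩⟩
  · simp only [Fintype.sum_bool]
    have hp t u := QRHL.isExpectation_restrictStar X M Y N t u (hA t u)
    exact ((hp _ _).add (hp _ _)).add ((hp _ _).add (hp _ _))
  · exact (QRHL.isExpectation_restrictStar X M Y N true true (hA true)).add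
      (QRHL.isExpectation_restrictStar X M Y N false false (hA false))
  -- The zero preconditions off the diagonal drop out of the double sum, leaving the two matching
  -- outcomes.
  · have key := QRHL.rhl_ifte X Y M N c d (fun t u => if t = u then A t else 0) B fun t u => by
      by_cases htu : t = u
      · subst htu; simpa using h t
      · simpa [htu] using QRHL.rhl_zero (hc t) (hd u) hB
    simpa [QRHL.restrictStar_zero] using key
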